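/- **Setting.** Fix $k\in\mathbb N$, $T\ge 0$ and constants $B,R,L,k_1$. States are $\{1,\dots,k\}$, the state $j$ being identified with the basis vector $e_j\in\mathbb R^k$; $|\cdot|$ is the Euclidean norm. *Hypothesis A.* $U\subset\mathbb R^k$ is convex with $|u|\le R$ on $U$; for $t\in[0,T]$, $y\in\mathbb R^k$ the kernel satisfies $0\le \nu_\ell(t,j,y)\le B$, $\nu_j(t,j,y)=0$, and $\nu_\ell(t,j,y)u_\ell\ge 0$ for $u\in U$. The one-player generator is $$(A[t,y,u]f)(j)=\sum_{\ell=1}^k \nu_\ell(t,j,y)\,u_\ell\,(f(\ell)-f(j)).$$ *Running payoff.* $J(t,j,y,u)=\sum_{\ell=1}^k J_{j,\ell}(t,y)u_\ell-|u|^2$ with real coefficients $J_{j,\ell}$. *Hypothesis B.* Each of the functions $\nu_\ell(t,j,y)$ and $J_{j,\ell}(t,y)$ is continuous in $t\in[0,T]$, and for each $t$ it is $C^1$ in $y\in\mathbb R^k$ and $L$-Lipschitz in $y$ with $L$-Lipschitz gradient. *Terminal payoff.* $V^T(j,\cdot)$ is $C^1$ on $\mathbb R^k$ and bounded with bounded gradient,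 for every $j$. *Coupled system.* A solution is a triple $(x,V,\Gamma)$ on $[0,T]$, $x_t\in\mathbb R^k$, $V(t,j)\in\mathbb R$, $\Gamma(t,j)\in U$, such that, with $A^*$ the adjoint of $A$ and each state $j$ using the control $\Gamma(t,j)$, $$\dot x_t=A^*[t,x_t,\Gamma(t,\cdot)]\,x_t,\qquad \frac{\partial V}{\partial t}(t,j)+\max_{u\in U}\bigl[J(t,j,x_t,u)+(A[t,x_t,u]V(t,\cdot))(j)\bigr]=0,\qquad V(T,j)=V^T(j,x_T),$$ and $\Gamma(t,j)$ attains the maximum. *The $N$-player game.* Player $i$ uses a feedback strategy $\gamma_i(t,j)$ of time and her own state. In the configuration $\xi=(\xi_1,\dots,\xi_N)$ with empirical measure $x^N(\xi)=\frac1N\sum_i e_{\xi_i}$, player $i$ jumps, independently of the others, from $\xi_i$ to $\ell\neq\xi_i$ at rate $\nu_\ell(t,\xi_i,x^N(\xi))\,\gamma_i(t,\xi_i)_\ell$. If $X=(X^1,\dots,X^N)$ is the resulting Markov jump process, the payoff of player $i$ is $$\mathbb E\Bigl[\int_0^T J\bigl(s,X^i_s,x^N(X_s),\gamma_i(s,X^i_s)\bigr)ds+V^T\bigl(X^i_T,x^N(X_T)\bigr)\Bigr].$$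 A strategy is admissible if it is $U$-valued and continuous in $t\in[0,T]$. A profile of admissible strategies is an $\varepsilon$-Nash equilibrium if no player can raise her payoff by more than $\varepsilon$ by changing to another admissible strategy while the other players keep theirs. *Norms* (values in $[0,\infty]$). - $\|J\|_{C(\mathcal U)}$ is the supremum of $|J|$ over $[0,T]\times\{1,\dots,k\}\times\mathbb R^k\times U$. - For $F$ of class $C^2$, $\|F\|_{C^2}$ is the supremum norm of $F$ plus the supremum norm of its second derivative; for $F$ not of class $C^2$ it is $\infty$. $\|V^T\|_{C^2}=\max_j\|V^T(j,\cdot)\|_{C^2}$. - $\|J\|_2^*=\sup_{y\in\mathbb R^k,\,u\in U}\ \sup\bigl\{\int_0^T\sum_j f_j(s)J(s,j,y,u)\,ds : f\in C^2([0,T],\mathbb R^k),\ \|f\|_{C^2}\le1\bigr\}$. **Theorem.** There is a constant $C=C(T)\ge0$, depending only on $T$ and on $k,B,R,L,k_1$, such that the following holds for all $U,\nu,J,V^T$ as above. Let the $N$-player games, $N\ge1$, start from configurations $\xi^N\in\{1,\dots,k\}^N$ whose empirical measures $x_0^N$ satisfy $|x_0^N-x_0|\le k_1/N$ for all $N\ge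 1$, for some $x_0\in\mathbb R^k$. Let $N\ge1$ and let $(x,V,\Gamma)$ be any solution of the coupled system whose flow starts at $x_0^N$ or at $x_0$. Then the profile in which every player uses the feedback strategy $\Gamma$ is an $\varepsilon$-Nash equilibrium of the $N$-player game started at $\xi^N$, with $$\varepsilon=\frac{C(T)}{N}\bigl(\|J\|_{C(\mathcal U)}+\|J\|^*_2+\|V^T\|_{C^2}+1\bigr).$$ -/

import Mathlib

open MeasureTheory Set Filter Topology
open scoped NNReal ENNReal

universe v

noncomputable section

/-- Euclidean space `ℝ^k`; it contains the controls and, the state `j` being identified with the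
basis vector `e_j`, the measures on the state space `{1, …, k}`. -/
abbrev E (k : ℕ) : Type := EuclideanSpace ℝ (Fin k)

/-- A feedback strategy `γ(t, j)` : time and own state determine the control vector. -/
abbrev Strategy (k : ℕ) : Type := ℝ → Fin k → E k

/-- The control set `U` and the jump kernel `ν t j ℓ y` (jump from `j` to `ℓ`, mean field `y`):
`U` is convex and bounded by `R`; the kernel is nonnegative, vanishes for `j = ℓ`, is bounded
by `B`, and the controlled rates `ν t j ℓ y * u ℓ` are off-diagonal entries of a `Q`-matrix. -/
structure HypothesisA {k : ℕ} (T B R : ℝ) (U : Set (E k))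
    (ν : ℝ → Fin k → Fin k → E k → ℝ) : Prop where
  convex : Convex ℝ U
  bounded : ∀ u ∈ U, ‖u‖ ≤ R
  diag : ∀ t ∈ Icc 0 T, ∀ j y, ν t j j y = 0
  nonneg : ∀ t ∈ Icc 0 T, ∀ j ℓ y, 0 ≤ ν t j ℓ y
  le_bound : ∀ t ∈ Icc 0 T, ∀ j ℓ y, ν t j ℓ y ≤ B
  rate_nonneg : ∀ t ∈ Icc 0 T, ∀ j ℓ y, ∀ u ∈ U, 0 ≤ ν t j ℓ y * u ℓ

/-- A function of `(t, y)` which is continuous in `t` and which, uniformly in `t`, is `L`-Lipschitz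
in `y` with a gradient that is `L`-Lipschitz in `y`. -/
structure IsRegularCoeff {k : ℕ} (T L : ℝ) (g : ℝ → E k → ℝ) : Prop where
  continuousOn : ∀ y, ContinuousOn (fun t => g t y) (Icc 0 T)
  contDiff : ∀ t ∈ Icc 0 T, ContDiff ℝ 1 (g t)
  lipschitz : ∀ t ∈ Icc 0 T, ∀ y z, |g t y - g t z| ≤ L * ‖y - z‖
  lipschitz_grad : ∀ t ∈ Icc 0 T, ∀ y z,
    ‖fderiv ℝ (g t) y - fderiv ℝ (g t) z‖ ≤ L * ‖y - z‖

/-- Regularity of the kernel `ν` and of the coefficients `J t j ℓ y` of the running payoff. -/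
structure HypothesisB {k : ℕ} (T L : ℝ) (ν J : ℝ → Fin k → Fin k → E k → ℝ) : Prop where
  kernel : ∀ j ℓ, IsRegularCoeff T L (fun t y => ν t j ℓ y)
  payoff : ∀ j ℓ, IsRegularCoeff T L (fun t y => J t j ℓ y)

/-- The running payoff `J(t, j, y, u) = ∑ ℓ, J_{j,ℓ}(t, y) u_ℓ - |u|²`. -/
def runningPayoff {k : ℕ} (J : ℝ → Fin k → Fin k → E k → ℝ) (t : ℝ) (j : Fin k) (y u : E k) : ℝ :=
  ∑ ℓ, J t j ℓ y * u ℓ - ‖u‖ ^ 2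

/-- The one-player generator `(A[t, y, u] f)(j) = ∑ ℓ, (f ℓ - f j) u_ℓ ν_ℓ(t, j, y)`. -/
def playerGen {k : ℕ} (ν : ℝ → Fin k → Fin k → E k → ℝ) (t : ℝ) (y u : E k)
    (f : Fin k → ℝ) (j : Fin k) : ℝ :=
  ∑ ℓ, ν t j ℓ y * u ℓ * (f ℓ - f j)

/-- The adjoint generator `A*[t, y, γ] p`, a player in state `j` using the control `γ j` :
its coordinate `ℓ` is the pairing of `p` with `A[t, y, γ] 1_ℓ`. -/
def adjointGen {k : ℕ} (ν : ℝ → Fin k → Fin k → E k → ℝ) (t : ℝ) (y : E k)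
    (γ : Fin k → E k) (p : E k) : E k :=
  WithLp.toLp 2 fun ℓ => ∑ j, p j * playerGen ν t y (γ j) (Pi.single ℓ 1) j

/-- The expression that is maximized over `u` in the Hamiltonian. -/
def preHamiltonian {k : ℕ} (ν J : ℝ → Fin k → Fin k → E k → ℝ) (t : ℝ) (j : Fin k) (y : E k)
    (W : Fin k → ℝ) (u : E k) : ℝ :=
  runningPayoff J t j y u + playerGen ν t y u W j

/-- The coupled system on `[0, T]` : `x` solves the kinetic equation `x' = A*[t, x, Γ] x`,
`V` solves the HJB equation `∂V/∂t + max_{u ∈ U} [J + A V] = 0` along the curve `x` with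
`V(T, j) = V^T(j, x_T)`, and the feedback `Γ(t, j)` attains the maximum. -/
structure IsMeanFieldSolution {k : ℕ} (T : ℝ) (U : Set (E k))
    (ν J : ℝ → Fin k → Fin k → E k → ℝ) (VT : Fin k → E k → ℝ)
    (x : ℝ → E k) (V : ℝ → Fin k → ℝ) (Γ : Strategy k) : Prop where
  kinetic : ∀ t ∈ Icc 0 T,
    HasDerivWithinAt x (adjointGen ν t (x t) (Γ t) (x t)) (Icc 0 T) t
  control_mem : ∀ t ∈ Icc 0 T, ∀ j, Γ t j ∈ U
  control_max : ∀ t ∈ Icc 0 T, ∀ j, IsMaxOn (preHamiltonian ν J t j (x t) (V t)) U (Γ t j)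
  hjb : ∀ t ∈ Icc 0 T, ∀ j, HasDerivWithinAt (fun s => V s j)
    (-preHamiltonian ν J t j (x t) (V t) (Γ t j)) (Icc 0 T) t
  terminal : ∀ j, V T j = VT j (x T)

/-- The empirical measure `(1/N) ∑ i, e_{ξ i}` of a configuration of `N` players. -/
def empirical {k N : ℕ} (ξ : Fin N → Fin k) : E k :=
  (N : ℝ)⁻¹ • ∑ i, EuclideanSpace.single (ξ i) (1 : ℝ)

/-- The generator of the `N`-player game in which player `i` uses the strategy `π i` :
each player jumps on her own, with the rates of `playerGen` at the empirical measure. -/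
def gameGen {k N : ℕ} (ν : ℝ → Fin k → Fin k → E k → ℝ) (π : Fin N → Strategy k) (t : ℝ)
    (f : (Fin N → Fin k) → ℝ) (ξ : Fin N → Fin k) : ℝ :=
  ∑ i, playerGen ν t (empirical ξ) (π i t (ξ i)) (fun ℓ => f (Function.update ξ i ℓ)) (ξ i)

/-- `X` is a jump process on `[0, T]` with generator `gameGen ν π t`, started at `ξ₀` :
a càdlàg solution of the martingale problem with respect to its own filtration. -/
structure IsGameProcess {k N : ℕ} (T : ℝ) (ν : ℝ → Fin k → Fin k → E k → ℝ)
    (π : Fin N → Strategy k) (ξ₀ : Fin N → Fin k) {Ω : Type v} [MeasurableSpace Ω]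
    (P : Measure Ω) (X : ℝ → Ω → (Fin N → Fin k)) : Prop where
  measurable : Measurable (Function.uncurry X)
  initial : ∀ᵐ ω ∂P, X 0 ω = ξ₀
  right_cont : ∀ ω, ∀ t ∈ Ico 0 T, ContinuousWithinAt (fun s => X s ω) (Ici t) t
  left_lim : ∀ ω, ∀ t ∈ Ioc 0 T, ∃ ξ, Tendsto (fun s => X s ω) (𝓝[<] t) (𝓝 ξ)
  martingale : ∀ f : (Fin N → Fin k) → ℝ, ∀ s ∈ Icc 0 T, ∀ t ∈ Icc s T, ∀ A : Set Ω,
    MeasurableSet[⨆ r ∈ Icc 0 s, MeasurableSpace.comap (X r) inferInstance] A →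
    ∫ ω in A, (f (X t ω) - f (X s ω) - ∫ r in s..t, gameGen ν π r f (X r ω)) ∂P = 0

/-- The expected payoff of player `i` who uses the strategy `γ`. -/
def expectedPayoff {k N : ℕ} (T : ℝ) (J : ℝ → Fin k → Fin k → E k → ℝ)
    (VT : Fin k → E k → ℝ) (i : Fin N) (γ : Strategy k) {Ω : Type v} [MeasurableSpace Ω]
    (P : Measure Ω) (X : ℝ → Ω → (Fin N → Fin k)) : ℝ :=
  ∫ ω, ((∫ s in (0 : ℝ)..T, runningPayoff J s (X s ω i) (empirical (X s ω)) (γ s (X s ω i)))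
    + VT (X T ω i) (empirical (X T ω))) ∂P

/-- Admissible strategies: with values in `U` and continuous in time. -/
structure IsAdmissible {k : ℕ} (T : ℝ) (U : Set (E k)) (γ : Strategy k) : Prop where
  mem : ∀ t ∈ Icc 0 T, ∀ j, γ t j ∈ U
  continuousOn : ∀ j, ContinuousOn (fun t => γ t j) (Icc 0 T)

/-- The profile `π` of admissible strategies is an `ε`-Nash equilibrium of the `N`-player game
started at `ξ₀` : no player `i` gains more than `ε` by a change to an admissible strategy `γ`.
The payoffs are computed with any realizations `X`, `X'` of the two controlled processes. -/
def IsEpsNash {k N : ℕ} (T : ℝ) (U : Set (E k)) (ν J : ℝ → Fin k → Fin k → E k → ℝ)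
    (VT : Fin k → E k → ℝ) (ξ₀ : Fin N → Fin k) (π : Fin N → Strategy k) (ε : ℝ≥0∞) : Prop :=
  (∀ i, IsAdmissible T U (π i)) ∧
  ∀ (i : Fin N) (γ : Strategy k), IsAdmissible T U γ →
    ∀ (Ω : Type v) [MeasurableSpace Ω] (P : Measure Ω) [IsProbabilityMeasure P]
      (X : ℝ → Ω → (Fin N → Fin k)),
    ∀ (Ω' : Type v) [MeasurableSpace Ω'] (P' : Measure Ω') [IsProbabilityMeasure P']
      (X' : ℝ → Ω' → (Fin N → Fin k)),
    IsGameProcess T ν π ξ₀ P X →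
    IsGameProcess T ν (Function.update π i γ) ξ₀ P' X' →
    ENNReal.ofReal (expectedPayoff T J VT i γ P' X' - expectedPayoff T J VT i (π i) P X) ≤ ε

/-- `F` is continuously differentiable and, together with its gradient, bounded. -/
def IsC1Bounded {k : ℕ} (F : E k → ℝ) : Prop :=
  ContDiff ℝ 1 F ∧ ∃ K : ℝ, ∀ y, |F y| ≤ K ∧ ‖fderiv ℝ F y‖ ≤ K

open Classical in
/-- The `C²` norm on a set `S` : the supremum norm of `F` plus that of its second derivative,
and `∞` if `F` is not twice continuously differentiable. -/
def c2Norm {F₁ F₂ : Type} [NormedAddCommGroup F₁] [NormedSpace ℝ F₁]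
    [NormedAddCommGroup F₂] [NormedSpace ℝ F₂] (S : Set F₁) (F : F₁ → F₂) : ℝ≥0∞ :=
  if ContDiff ℝ 2 F then (⨆ y ∈ S, ‖F y‖ₑ) + ⨆ y ∈ S, ‖iteratedFDeriv ℝ 2 F y‖ₑ else ∞

/-- The supremum norm of the running payoff over `[0, T] × {1, …, k} × ℝ^k × U`. -/
def payoffSupNorm {k : ℕ} (T : ℝ) (U : Set (E k)) (J : ℝ → Fin k → Fin k → E k → ℝ) : ℝ≥0∞ :=
  ⨆ t ∈ Icc 0 T, ⨆ j, ⨆ y, ⨆ u ∈ U, ‖runningPayoff J t j y u‖ₑ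

/-- The weak-* norm of the running payoff: the supremum, over `y ∈ ℝ^k` and `u ∈ U`, of the norm
of the curve `s ↦ (J(s, j, y, u))_j` as a functional on the unit ball of `C²([0, T], ℝ^k)`. -/
def payoffDualNorm {k : ℕ} (T : ℝ) (U : Set (E k)) (J : ℝ → Fin k → Fin k → E k → ℝ) : ℝ≥0∞ :=
  ⨆ y, ⨆ u ∈ U, ⨆ f : ℝ → E k, ⨆ _ : c2Norm (Icc 0 T) f ≤ 1,
    ENNReal.ofReal (∫ s in (0 : ℝ)..T, ∑ j, f s j * runningPayoff J s j y u)

end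

/-!
Fix a player `i` who uses an arbitrary admissible strategy `γ` while all others use the mean field
feedback `Γ`. As the configuration space is finite, the law of the game solves a linear ordinary
differential equation (`IsGameProcess.isForwardLaw`, the case `A = Ω`, `s = 0` of the martingale
problem), and the rest of the argument only concerns this law and its Dynkin formula.

Let `μ` be the empirical measure and `x` the mean field flow. Two Grönwall arguments give the rate
`1/N`. The second moment `E ‖μ - x‖²` is `O(1/N)`, since each jump moves `μ` by `O(1/N)` and there
are `O(N)` jumps (`exists_second_moment_le`). The mixed moments `E [(μ - x) 1_{ξ i = j}]` are
`O(1/N)` as well: by a first order expansion of the rates at `x` they solve a linear system whose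
inhomogeneity is controlled by the second moment and by the influence `O(1/N)` of a single player
(`exists_mixed_moment_le`). Hence replacing `μ` by `x` in any observable of `(ξ i, μ)` with a
first order expansion at `x` and a quadratic remainder changes the expectation by `O(1/N)` only
(`exists_expect_sub_le`).

The theorem then follows by verification. The value function `V` of the limit problem, evaluated at
the state of player `i`, satisfies the Hamilton-Jacobi-Bellman equation with `x` in place of `μ`,
so that her payoff is at most `V (0, ξ₀ i) + O(1/N)`, and equal to `V (0, ξ₀ i) + O(1/N)` if
`γ = Γ` (`exists_payoff_sub_value_le`). The constants are linear in the sup norm of `J` and the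
`C²` norm of the terminal payoff because `V` is bounded by them. The feedback `Γ` is continuous in
time since the maximizer of a uniformly concave function depends continuously on the data
(`IsMeanFieldSolution.isAdmissible`). The regularity of the coefficients `J` in the mean field
variable makes the dual norm of `J` dispensable in the estimate.
-/

/-! ### Grönwall estimates -/

/-- Grönwall's inequality with a cruder constant that is homogeneous in `(δ, ε)`: data of order
`1/N` give a bound of order `1/N`. -/
theorem norm_le_of_norm_deriv_le {F : Type*} [NormedAddCommGroup F] [NormedSpace ℝ F]
    {f f' : ℝ → F} {T K δ ε : ℝ} (hK : 1 ≤ K) (hε : 0 ≤ ε) (h0 : ‖f 0‖ ≤ δ)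
    (hf : ∀ t ∈ Icc 0 T, HasDerivWithinAt f (f' t) (Icc 0 T) t)
    (bound : ∀ t ∈ Icc 0 T, ‖f' t‖ ≤ K * ‖f t‖ + ε) :
    ∀ t ∈ Icc 0 T, ‖f t‖ ≤ (δ + ε) * Real.exp (K * T) := by
  intro t ht
  have hδ : 0 ≤ δ := (norm_nonneg _).trans h0
  have h := norm_le_gronwallBound_of_norm_deriv_right_le (f := f) (f' := f') (δ := δ) (K := K)
    (ε := ε) (a := 0) (b := T) (fun s hs => (hf s hs).continuousWithinAt)
    (fun s hs => (hf s ⟨hs.1, hs.2.le⟩).mono_of_mem_nhdsWithin (Icc_mem_nhdsGE_of_mem hs)) h0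
    (fun s hs => bound s ⟨hs.1, hs.2.le⟩) t ht
  refine h.trans ?_
  rw [gronwallBound_of_K_ne_0 (by positivity), sub_zero]
  have e1 : Real.exp (K * t) ≤ Real.exp (K * T) :=
    Real.exp_le_exp.2 (mul_le_mul_of_nonneg_left ht.2 (by positivity))
  have e2 : ε / K ≤ ε := div_le_self hε hK
  have e3 : ε / K * (Real.exp (K * t) - 1) ≤ ε * Real.exp (K * T) := by
    refine mul_le_mul e2 (by linarith) ?_ hε
    have : 0 ≤ K * t := mul_nonneg (by positivity) ht.1
    linarith [Real.one_le_exp this]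
  have e4 := mul_le_mul_of_nonneg_left e1 hδ
  linarith

/-- The same estimate for a terminal value problem. -/
theorem norm_le_of_norm_deriv_le_backward {F : Type*} [NormedAddCommGroup F] [NormedSpace ℝ F]
    {f f' : ℝ → F} {T K δ ε : ℝ} (hK : 1 ≤ K) (hε : 0 ≤ ε) (hT : ‖f T‖ ≤ δ)
    (hf : ∀ t ∈ Icc 0 T, HasDerivWithinAt f (f' t) (Icc 0 T) t)
    (bound : ∀ t ∈ Icc 0 T, ‖f' t‖ ≤ K * ‖f t‖ + ε) :
    ∀ t ∈ Icc 0 T, ‖f t‖ ≤ (δ + ε) * Real.exp (K * T) := by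
  have hmaps : ∀ t ∈ Icc 0 T, T - t ∈ Icc 0 T := fun t ht =>
    ⟨by linarith [ht.2], by linarith [ht.1]⟩
  have key := norm_le_of_norm_deriv_le (f := fun s => f (T - s)) (f' := fun s => -f' (T - s))
    (T := T) hK hε (by simpa using hT)
    (fun t ht => by
      have h1 : HasDerivWithinAt (fun s : ℝ => T - s) (-1) (Icc 0 T) t := by
        simpa using (hasDerivWithinAt_id t (Icc 0 T)).const_sub T
      simpa [Function.comp_def] using HasDerivWithinAt.scomp t (hf _ (hmaps t ht)) h1 hmaps)
    (fun t ht => by simpa using bound _ (hmaps t ht))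
  intro t ht
  simpa using key _ (hmaps t ht)

theorem hasDerivWithinAt_integral_of_continuousOn {f : ℝ → ℝ} {T : ℝ}
    (hf : ContinuousOn f (Icc 0 T)) {t : ℝ} (ht : t ∈ Icc 0 T) :
    HasDerivWithinAt (fun s => ∫ r in (0 : ℝ)..s, f r) (f t) (Icc 0 T) t := by
  have hT : (0 : ℝ) ≤ T := ht.1.trans ht.2
  have hc : Continuous (IccExtend hT ((Icc 0 T).domRestrict f)) :=
    (continuousOn_iff_continuous_domRestrict.1 hf).Icc_extend'
  have h := (hc.integral_hasStrictDerivAt 0 t).hasDerivAt.hasDerivWithinAt (s := Icc 0 T)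
  have he : ∀ r ∈ Icc 0 T, IccExtend hT ((Icc 0 T).domRestrict f) r = f r := fun r hr => by
    rw [IccExtend_of_mem _ _ hr]; rfl
  rw [he t ht] at h
  refine h.congr (fun s hs => ?_) ?_
  · refine intervalIntegral.integral_congr fun r hr => (he r ?_).symm
    rw [uIcc_of_le hs.1] at hr
    exact ⟨hr.1, hr.2.trans hs.2⟩
  · refine intervalIntegral.integral_congr fun r hr => (he r ?_).symm
    rw [uIcc_of_le ht.1] at hr
    exact ⟨hr.1, hr.2.trans ht.2⟩

/-- The mean value inequality with a one-sided bound on the derivative. -/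
theorem le_add_mul_of_deriv_le {f f' : ℝ → ℝ} {T c : ℝ} (hT : 0 ≤ T)
    (hf : ∀ t ∈ Icc 0 T, HasDerivWithinAt f (f' t) (Icc 0 T) t)
    (bound : ∀ t ∈ Icc 0 T, f' t ≤ c) : f T ≤ f 0 + c * T := by
  have h := image_le_of_deriv_right_le_deriv_boundary (f := f) (f' := f') (a := 0) (b := T)
    (fun s hs => (hf s hs).continuousWithinAt)
    (fun s hs => (hf s ⟨hs.1, hs.2.le⟩).mono_of_mem_nhdsWithin (Icc_mem_nhdsGE_of_mem hs))
    (B := fun t => f 0 + c * t) (B' := fun _ => c) (by simp) (by fun_prop)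
    (fun s _ => by
      simpa using (((hasDerivAt_id s).const_mul c).const_add (f 0)).hasDerivWithinAt (s := Ici s))
    (fun s hs => bound s ⟨hs.1, hs.2.le⟩)
  exact h ⟨hT, le_rfl⟩

/-! ### First order expansions with a quadratic remainder -/

/-- `F` has at `x` a first order expansion whose coefficients, and whose quadratic remainder on
the whole space, are bounded by `K`. -/
def HasTaylorBound {k : ℕ} (K : ℝ) (x : E k) (F : E k → ℝ) : Prop :=
  ∃ c : Fin k → ℝ, (∀ a, |c a| ≤ K) ∧
    ∀ y, |F y - F x - ∑ a, c a * (y a - x a)| ≤ K * ‖y - x‖ ^ 2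

theorem eq_sum_smul_single {k : ℕ} (v : E k) : v = ∑ a, v a • EuclideanSpace.single a (1 : ℝ) := by
  ext b
  simp [Pi.single_apply]

theorem abs_apply_le_norm {k : ℕ} (v : E k) (a : Fin k) : |v a| ≤ ‖v‖ := by
  simpa using PiLp.norm_apply_le v a

theorem norm_le_sum_abs {k : ℕ} (v : E k) : ‖v‖ ≤ ∑ a, |v a| := by
  calc ‖v‖ = ‖∑ a, v a • EuclideanSpace.single a (1 : ℝ)‖ := by rw [← eq_sum_smul_single]
    _ ≤ ∑ a, ‖v a • EuclideanSpace.single a (1 : ℝ)‖ := norm_sum_le _ _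
    _ = ∑ a, |v a| := by simp [norm_smul]

namespace HasTaylorBound

variable {k : ℕ} {K K' : ℝ} {x : E k} {F G : E k → ℝ}

theorem mono (h : HasTaylorBound K x F) (hK : K ≤ K') : HasTaylorBound K' x F := by
  obtain ⟨c, hc, hF⟩ := h
  exact ⟨c, fun a => (hc a).trans hK, fun y => (hF y).trans (by gcongr)⟩

theorem const (r : ℝ) (hK : 0 ≤ K) : HasTaylorBound K x (fun _ => r) :=
  ⟨0, fun a => by simpa using hK, fun y => by simpa using by positivity⟩

theorem add (hF : HasTaylorBound K x F) (hG : HasTaylorBound K' x G) :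
    HasTaylorBound (K + K') x (fun y => F y + G y) := by
  obtain ⟨c, hc, hF⟩ := hF
  obtain ⟨d, hd, hG⟩ := hG
  refine ⟨c + d, fun a => (abs_add_le _ _).trans (add_le_add (hc a) (hd a)), fun y => ?_⟩
  have : F y + G y - (F x + G x) - ∑ a, (c + d) a * (y a - x a)
      = (F y - F x - ∑ a, c a * (y a - x a)) + (G y - G x - ∑ a, d a * (y a - x a)) := by
    simp only [Pi.add_apply, add_mul, Finset.sum_add_distrib]; ring
  rw [this, add_mul]
  exact (abs_add_le _ _).trans (add_le_add (hF y) (hG y))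

theorem const_mul (hF : HasTaylorBound K x F) (r : ℝ) :
    HasTaylorBound (|r| * K) x (fun y => r * F y) := by
  obtain ⟨c, hc, hF⟩ := hF
  refine ⟨fun a => r * c a, fun a => ?_, fun y => ?_⟩
  · rw [abs_mul]; exact mul_le_mul_of_nonneg_left (hc a) (abs_nonneg r)
  · have : r * F y - r * F x - ∑ a, r * c a * (y a - x a)
        = r * (F y - F x - ∑ a, c a * (y a - x a)) := by
      simp only [mul_assoc, ← Finset.mul_sum]; ring
    rw [this, abs_mul, mul_assoc]
    exact mul_le_mul_of_nonneg_left (hF y) (abs_nonneg r)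

theorem sum {ι : Type*} (s : Finset ι) {F : ι → E k → ℝ} (h : ∀ i, HasTaylorBound K x (F i)) :
    HasTaylorBound (s.card * K) x (fun y => ∑ i ∈ s, F i y) := by
  classical
  induction s using Finset.induction_on with
  | empty => simpa using const (K := 0) (x := x) 0 le_rfl
  | insert i s hi ih =>
    simp only [Finset.sum_insert hi, Finset.card_insert_of_notMem hi]
    exact ((h i).add ih).mono (by push_cast; linarith)

/-- The product with a coordinate; the remainder contains the product of the two increments. -/
theorem coord_mul {L B X : ℝ} (hF : HasTaylorBound K x F) (j : Fin k)
    (hL : ∀ y, |F y - F x| ≤ L * ‖y - x‖) (hB : |F x| ≤ B) (hX : |x j| ≤ X)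
    (hL0 : 0 ≤ L) :
    HasTaylorBound (X * K + B + L) x (fun y => y j * F y) := by
  obtain ⟨c, hc, hF⟩ := hF
  have hX0 : 0 ≤ X := (abs_nonneg _).trans hX
  have hB0 : 0 ≤ B := (abs_nonneg _).trans hB
  refine ⟨fun a => x j * c a + if a = j then F x else 0, fun a => ?_, fun y => ?_⟩
  · have h1 : |x j * c a| ≤ X * K := by
      rw [abs_mul]; exact mul_le_mul hX (hc a) (abs_nonneg _) hX0
    have h2 : |if a = j then F x else 0| ≤ B := by split_ifs <;> simp [hB, hB0]
    exact (abs_add_le _ _).trans (by linarith)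
  · have : y j * F y - x j * F x
        - ∑ a, (x j * c a + if a = j then F x else 0) * (y a - x a)
        = x j * (F y - F x - ∑ a, c a * (y a - x a)) + (y j - x j) * (F y - F x) := by
      simp only [add_mul, Finset.sum_add_distrib, ite_mul, zero_mul, Finset.sum_ite_eq',
        Finset.mem_univ, if_true, mul_assoc, ← Finset.mul_sum]
      ring
    rw [this]
    refine (abs_add_le _ _).trans ?_
    rw [abs_mul, abs_mul]
    have h1 : |x j| * |F y - F x - ∑ a, c a * (y a - x a)| ≤ X * (K * ‖y - x‖ ^ 2) :=
      mul_le_mul hX (hF y) (abs_nonneg _) hX0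
    have h2 : |y j - x j| * |F y - F x| ≤ ‖y - x‖ * (L * ‖y - x‖) :=
      mul_le_mul (by simpa using abs_apply_le_norm (y - x) j) (hL y) (abs_nonneg _)
        (norm_nonneg _)
    nlinarith [mul_nonneg hB0 (sq_nonneg ‖y - x‖)]

/-- A differentiable function whose gradient is bounded at `x` and Lipschitz. -/
theorem of_lipschitz_fderiv (hF : Differentiable ℝ F) (hK : ‖fderiv ℝ F x‖ ≤ K)
    (hlip : ∀ y z, ‖fderiv ℝ F y - fderiv ℝ F z‖ ≤ K * ‖y - z‖) : HasTaylorBound K x F := by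
  have hK0 : 0 ≤ K := (norm_nonneg _).trans hK
  refine ⟨fun a => fderiv ℝ F x (EuclideanSpace.single a 1), fun a => ?_, fun y => ?_⟩
  · have := (fderiv ℝ F x).le_opNorm (EuclideanSpace.single a 1)
    simp only [PiLp.norm_single, norm_one, mul_one, Real.norm_eq_abs] at this
    exact this.trans hK
  · have h1 : ∑ a, fderiv ℝ F x (EuclideanSpace.single a 1) * (y a - x a)
        = fderiv ℝ F x (y - x) := by
      conv_rhs => rw [eq_sum_smul_single (y - x)]
      simp [mul_comm]
    rw [h1]
    have h := (convex_segment x y).norm_image_sub_le_of_norm_hasFDerivWithin_le' (f := F)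
      (f' := fderiv ℝ F) (φ := fderiv ℝ F x) (C := K * ‖y - x‖)
      (fun z _ => (hF z).hasFDerivAt.hasFDerivWithinAt)
      (fun z hz => (hlip z x).trans (mul_le_mul_of_nonneg_left
        (norm_sub_le_of_mem_segment hz) hK0))
      (left_mem_segment ℝ x y) (right_mem_segment ℝ x y)
    rw [Real.norm_eq_abs] at h
    rw [pow_two, ← mul_assoc]
    exact h

end HasTaylorBound

theorem IsRegularCoeff.hasTaylorBound {k : ℕ} {T L : ℝ} {g : ℝ → E k → ℝ}
    (hg : IsRegularCoeff T L g) (hL : 0 ≤ L) {t : ℝ} (ht : t ∈ Icc 0 T) (x : E k) :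
    HasTaylorBound L x (g t) := by
  refine .of_lipschitz_fderiv ((hg.contDiff t ht).differentiable (by norm_num)) ?_
    (hg.lipschitz_grad t ht)
  have : LipschitzWith ⟨L, hL⟩ (g t) := LipschitzWith.of_dist_le_mul fun y z => by
    rw [Real.dist_eq, dist_eq_norm]; exact hg.lipschitz t ht y z
  exact norm_fderiv_le_of_lipschitz ℝ this

/-- Bounds on `F` and on its second derivative control the gradient as well: compare `F` at
two points at distance one. -/
theorem hasTaylorBound_of_second_derivative {k : ℕ} {F : E k → ℝ} {M H : ℝ} (hF : ContDiff ℝ 2 F)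
    (hM : ∀ y, |F y| ≤ M) (hH : ∀ y, ‖iteratedFDeriv ℝ 2 F y‖ ≤ H) (x : E k) :
    HasTaylorBound (2 * M + H) x F := by
  have hM0 : 0 ≤ M := (abs_nonneg _).trans (hM x)
  have hH0 : 0 ≤ H := (norm_nonneg _).trans (hH x)
  have hd : Differentiable ℝ F := hF.differentiable (by norm_num)
  have hd2 : Differentiable ℝ (fderiv ℝ F) :=
    (hF.fderiv_right (m := 1) (by norm_num)).differentiable (by norm_num)
  have h2 : ∀ y, ‖fderiv ℝ (fderiv ℝ F) y‖ ≤ H := fun y => by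
    have := hH y
    rwa [show (2 : ℕ) = 1 + 1 from rfl, ← norm_iteratedFDeriv_fderiv,
      norm_iteratedFDeriv_one] at this
  have hlip : ∀ y z, ‖fderiv ℝ F y - fderiv ℝ F z‖ ≤ H * ‖y - z‖ := fun y z =>
    Convex.norm_image_sub_le_of_norm_fderiv_le (fun w _ => hd2 w) (fun w _ => h2 w)
      convex_univ (mem_univ z) (mem_univ y)
  refine .of_lipschitz_fderiv hd ?_ fun y z => (hlip y z).trans (by gcongr; linarith)
  refine ContinuousLinearMap.opNorm_le_of_unit_norm (by positivity) fun v hv => ?_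
  have h := (convex_segment x (x + v)).norm_image_sub_le_of_norm_hasFDerivWithin_le' (f := F)
      (f' := fderiv ℝ F) (φ := fderiv ℝ F x) (C := H)
      (fun z _ => (hd z).hasFDerivAt.hasFDerivWithinAt)
      (fun z hz => (hlip z x).trans (by
        have := norm_sub_le_of_mem_segment hz
        simp only [add_sub_cancel_left, hv] at this
        exact mul_le_of_le_one_right hH0 this))
      (left_mem_segment ℝ x (x + v)) (right_mem_segment ℝ x (x + v))
  simp only [add_sub_cancel_left, hv, mul_one, Real.norm_eq_abs] at h
  rw [Real.norm_eq_abs]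
  have h3 := abs_le.1 h
  have h4 := abs_le.1 (hM x)
  have h5 := abs_le.1 (hM (x + v))
  exact abs_le.2 ⟨by linarith, by linarith⟩

/-! ### The generators -/

namespace HypothesisA

variable {k : ℕ} {T B R : ℝ} {U : Set (E k)} {ν : ℝ → Fin k → Fin k → E k → ℝ}

theorem abs_rate_le (hA : HypothesisA T B R U ν) {t : ℝ} (ht : t ∈ Icc 0 T) (j ℓ : Fin k) (y : E k)
    {u : E k} (hu : u ∈ U) : |ν t j ℓ y * u ℓ| ≤ B * R := by
  have h0 := hA.nonneg t ht j ℓ y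
  have h1 := hA.le_bound t ht j ℓ y
  rw [abs_mul, abs_of_nonneg h0]
  exact mul_le_mul h1 ((abs_apply_le_norm u ℓ).trans (hA.bounded u hu)) (abs_nonneg _)
    (h0.trans h1)

theorem abs_playerGen_le (hA : HypothesisA T B R U ν) {t : ℝ} (ht : t ∈ Icc 0 T) (j : Fin k)
    (y : E k) {u : E k} (hu : u ∈ U) {f : Fin k → ℝ} {K : ℝ} (hf : ∀ ℓ, |f ℓ| ≤ K) :
    |playerGen ν t y u f j| ≤ k * (B * R * (2 * K)) := by
  refine (Finset.abs_sum_le_sum_abs _ _).trans ?_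
  refine (Finset.sum_le_card_nsmul _ _ (B * R * (2 * K)) fun ℓ _ => ?_).trans (by simp)
  rw [abs_mul]
  refine mul_le_mul (hA.abs_rate_le ht j ℓ y hu) ?_ (abs_nonneg _)
    ((abs_nonneg _).trans (hA.abs_rate_le ht j ℓ y hu))
  exact (abs_sub _ _).trans (by linarith [hf ℓ, hf j])

theorem abs_playerGen_sub_le (hA : HypothesisA T B R U ν) {L : ℝ}
    (hν : ∀ j ℓ, IsRegularCoeff T L (fun t y => ν t j ℓ y)) {t : ℝ} (ht : t ∈ Icc 0 T) (j : Fin k)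
    (y z : E k) {u : E k} (hu : u ∈ U) {f : Fin k → ℝ} {K : ℝ} (hf : ∀ ℓ, |f ℓ| ≤ K) :
    |playerGen ν t y u f j - playerGen ν t z u f j| ≤ k * (L * R * (2 * K)) * ‖y - z‖ := by
  have hs : playerGen ν t y u f j - playerGen ν t z u f j
      = ∑ ℓ, (ν t j ℓ y - ν t j ℓ z) * u ℓ * (f ℓ - f j) := by
    simp only [playerGen, ← Finset.sum_sub_distrib]
    exact Finset.sum_congr rfl fun ℓ _ => by ring
  rw [hs]
  refine (Finset.abs_sum_le_sum_abs _ _).trans ?_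
  refine (Finset.sum_le_card_nsmul _ _ (L * ‖y - z‖ * R * (2 * K)) fun ℓ _ => ?_).trans
    (by simp only [Finset.card_univ, Fintype.card_fin, nsmul_eq_mul]; exact le_of_eq (by ring))
  have h1 := (hν j ℓ).lipschitz t ht y z
  have h2 := (abs_apply_le_norm u ℓ).trans (hA.bounded u hu)
  have h0 := (abs_nonneg _).trans h1
  have hR := (abs_nonneg _).trans h2
  rw [abs_mul, abs_mul]
  refine mul_le_mul (mul_le_mul h1 h2 (abs_nonneg _) h0) ?_ (abs_nonneg _) (by positivity)
  exact (abs_sub _ _).trans (by linarith [hf ℓ, hf j])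

theorem hasTaylorBound_playerGen (hA : HypothesisA T B R U ν) {L : ℝ} (hL : 0 ≤ L)
    (hν : ∀ j ℓ, IsRegularCoeff T L (fun t y => ν t j ℓ y)) {t : ℝ} (ht : t ∈ Icc 0 T) (j : Fin k)
    (x : E k) {u : E k} (hu : u ∈ U) {f : Fin k → ℝ} {K : ℝ} (hf : ∀ ℓ, |f ℓ| ≤ K) :
    HasTaylorBound (k * (L * R * (2 * K))) x (fun y => playerGen ν t y u f j) := by
  have h : ∀ ℓ, HasTaylorBound (L * R * (2 * K)) x
      (fun y => ν t j ℓ y * u ℓ * (f ℓ - f j)) := fun ℓ => by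
    have h2 := (abs_apply_le_norm u ℓ).trans (hA.bounded u hu)
    have h3 : |f ℓ - f j| ≤ 2 * K := (abs_sub _ _).trans (by linarith [hf ℓ, hf j])
    have h4 : |u ℓ * (f ℓ - f j)| ≤ R * (2 * K) := by
      rw [abs_mul]
      exact mul_le_mul h2 h3 (abs_nonneg _) ((abs_nonneg _).trans h2)
    have := (((hν j ℓ).hasTaylorBound hL ht x).const_mul (u ℓ * (f ℓ - f j))).mono
      (mul_le_mul_of_nonneg_right h4 hL)
    convert this using 1
    · ring
    · funext y; ring
  simpa [playerGen] using HasTaylorBound.sum Finset.univ h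

end HypothesisA

theorem abs_single_le {k : ℕ} (a ℓ : Fin k) : |(Pi.single a 1 : Fin k → ℝ) ℓ| ≤ 1 := by
  rw [Pi.single_apply]; split_ifs <;> simp

theorem adjointGen_apply {k : ℕ} (ν : ℝ → Fin k → Fin k → E k → ℝ) (t : ℝ) (y : E k)
    (γ : Fin k → E k) (p : E k) (a : Fin k) :
    adjointGen ν t y γ p a = ∑ j, p j * playerGen ν t y (γ j) (Pi.single a 1) j := rfl

theorem empirical_apply {k N : ℕ} (ξ : Fin N → Fin k) (a : Fin k) :
    empirical ξ a = (N : ℝ)⁻¹ * ∑ n, (Pi.single a 1 : Fin k → ℝ) (ξ n) := by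
  simp [empirical, Pi.single_apply, eq_comm]

theorem sum_empirical_mul {k N : ℕ} (ξ : Fin N → Fin k) (h : Fin k → ℝ) :
    ∑ j, empirical ξ j * h j = (N : ℝ)⁻¹ * ∑ n, h (ξ n) := by
  simp only [empirical_apply, mul_assoc, ← Finset.mul_sum, Finset.sum_mul]
  rw [Finset.sum_comm]
  simp [Pi.single_apply]

theorem norm_empirical_le {k N : ℕ} (ξ : Fin N → Fin k) : ‖empirical ξ‖ ≤ 1 := by
  rw [empirical, norm_smul, norm_inv, Real.norm_natCast]
  refine (mul_le_mul_of_nonneg_left (norm_sum_le _ _) (by positivity)).trans ?_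
  simpa using inv_mul_le_one

theorem empirical_update_sub {k N : ℕ} (ξ : Fin N → Fin k) (n : Fin N) (ℓ a : Fin k) :
    empirical (Function.update ξ n ℓ) a - empirical ξ a
      = (N : ℝ)⁻¹ * ((Pi.single a 1 : Fin k → ℝ) ℓ - (Pi.single a 1 : Fin k → ℝ) (ξ n)) := by
  rw [empirical_apply, empirical_apply, ← mul_sub, ← Finset.sum_sub_distrib,
    Finset.sum_eq_single n (fun m _ hm => by simp [Function.update_of_ne hm]) (by simp)]
  simp

theorem abs_empirical_update_sub_le {k N : ℕ} (ξ : Fin N → Fin k) (n : Fin N) (ℓ a : Fin k) :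
    |empirical (Function.update ξ n ℓ) a - empirical ξ a| ≤ (N : ℝ)⁻¹ := by
  rw [empirical_update_sub, abs_mul, abs_of_nonneg (by positivity : (0 : ℝ) ≤ (N : ℝ)⁻¹)]
  refine mul_le_of_le_one_right (by positivity) ?_
  rw [Pi.single_apply, Pi.single_apply]; split_ifs <;> simp

/-- The carré du champ of `gameGen`: the defect in the Leibniz rule. -/
noncomputable def gameCarre {k N : ℕ} (ν : ℝ → Fin k → Fin k → E k → ℝ)
    (π : Fin N → Strategy k) (t : ℝ) (f g : (Fin N → Fin k) → ℝ) (ξ : Fin N → Fin k) : ℝ :=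
  ∑ n, ∑ ℓ, ν t (ξ n) ℓ (empirical ξ) * π n t (ξ n) ℓ *
    ((f (Function.update ξ n ℓ) - f ξ) * (g (Function.update ξ n ℓ) - g ξ))

section gameGen

variable {k N : ℕ} {ν : ℝ → Fin k → Fin k → E k → ℝ} {π : Fin N → Strategy k} {t : ℝ}

theorem gameGen_mul (f g : (Fin N → Fin k) → ℝ) (ξ : Fin N → Fin k) :
    gameGen ν π t (fun η => f η * g η) ξ
      = f ξ * gameGen ν π t g ξ + g ξ * gameGen ν π t f ξ + gameCarre ν π t f g ξ := by
  simp only [gameGen, playerGen, gameCarre, Function.update_eq_self, Finset.mul_sum,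
    ← Finset.sum_add_distrib]
  exact Finset.sum_congr rfl fun n _ => Finset.sum_congr rfl fun ℓ _ => by ring

theorem gameGen_sub_const (f : (Fin N → Fin k) → ℝ) (c : ℝ) (ξ : Fin N → Fin k) :
    gameGen ν π t (fun η => f η - c) ξ = gameGen ν π t f ξ := by
  simp [gameGen, playerGen]

theorem gameGen_sum {ι : Type*} (s : Finset ι) (f : ι → (Fin N → Fin k) → ℝ) (ξ : Fin N → Fin k) :
    gameGen ν π t (fun η => ∑ a ∈ s, f a η) ξ = ∑ a ∈ s, gameGen ν π t (f a) ξ := by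
  simp only [gameGen, playerGen, ← Finset.sum_sub_distrib, Finset.mul_sum]
  symm
  rw [Finset.sum_comm]
  exact Finset.sum_congr rfl fun n _ => Finset.sum_comm

theorem gameGen_player (i : Fin N) (h : Fin k → ℝ) (ξ : Fin N → Fin k) :
    gameGen ν π t (fun η => h (η i)) ξ = playerGen ν t (empirical ξ) (π i t (ξ i)) h (ξ i) := by
  rw [gameGen, Finset.sum_eq_single i _ (by simp)]
  · simp
  · intro n _ hn
    simp [playerGen, Function.update_of_ne hn.symm]

theorem gameGen_empirical (a : Fin k) (ξ : Fin N → Fin k) :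
    gameGen ν π t (fun η => empirical η a) ξ
      = (N : ℝ)⁻¹ * ∑ n, playerGen ν t (empirical ξ) (π n t (ξ n)) (Pi.single a 1) (ξ n) := by
  rw [gameGen, Finset.mul_sum]
  refine Finset.sum_congr rfl fun n _ => ?_
  simp only [playerGen, Finset.mul_sum]
  refine Finset.sum_congr rfl fun ℓ _ => ?_
  rw [Function.update_eq_self, empirical_update_sub]; ring

variable {T B R : ℝ} {U : Set (E k)}

/-- All `N` players contribute, each with a squared jump of order `N⁻²`. -/
theorem HypothesisA.abs_gameCarre_empirical_le (hA : HypothesisA T B R U ν) (ht : t ∈ Icc 0 T)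
    (hπ : ∀ n j, π n t j ∈ U) (a : Fin k) (c : ℝ) (ξ : Fin N → Fin k) :
    |gameCarre ν π t (fun η => empirical η a - c) (fun η => empirical η a - c) ξ|
      ≤ k * (B * R) * (N : ℝ)⁻¹ := by
  have hterm : ∀ n ℓ, |ν t (ξ n) ℓ (empirical ξ) * π n t (ξ n) ℓ *
      ((empirical (Function.update ξ n ℓ) a - c - (empirical ξ a - c))
        * (empirical (Function.update ξ n ℓ) a - c - (empirical ξ a - c)))|
      ≤ B * R * ((N : ℝ)⁻¹ * (N : ℝ)⁻¹) := fun n ℓ => by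
    have h1 := hA.abs_rate_le ht (ξ n) ℓ (empirical ξ) (hπ n (ξ n))
    have h2 := abs_empirical_update_sub_le ξ n ℓ a
    rw [sub_sub_sub_cancel_right, abs_mul (_ * _), abs_mul (_ - _)]
    exact mul_le_mul h1 (mul_le_mul h2 h2 (abs_nonneg _) (by positivity)) (by positivity)
      ((abs_nonneg _).trans h1)
  refine (Finset.abs_sum_le_sum_abs _ _).trans ?_
  refine (Finset.sum_le_card_nsmul _ _ (k * (B * R * ((N : ℝ)⁻¹ * (N : ℝ)⁻¹)))
    fun n _ => ?_).trans ?_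
  · refine (Finset.abs_sum_le_sum_abs _ _).trans ?_
    exact (Finset.sum_le_card_nsmul _ _ _ fun ℓ _ => hterm n ℓ).trans (by simp)
  · simp only [Finset.card_univ, Fintype.card_fin, nsmul_eq_mul]
    rcases eq_or_ne (N : ℝ) 0 with h | h
    · simp [h]
    · exact le_of_eq (by field_simp)

/-- Only the jumps of player `i` change both functions, the empirical measure by `N⁻¹`. -/
theorem HypothesisA.abs_gameCarre_player_le (hA : HypothesisA T B R U ν) (ht : t ∈ Icc 0 T)
    (hπ : ∀ n j, π n t j ∈ U) (a : Fin k) (c : ℝ) (i : Fin N) (j : Fin k) (ξ : Fin N → Fin k) :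
    |gameCarre ν π t (fun η => empirical η a - c) (fun η => (Pi.single j 1 : Fin k → ℝ) (η i)) ξ|
      ≤ k * (B * R) * (N : ℝ)⁻¹ := by
  rw [gameCarre, Finset.sum_eq_single i _ (by simp)]
  · refine (Finset.abs_sum_le_sum_abs _ _).trans ?_
    refine (Finset.sum_le_card_nsmul _ _ (B * R * (N : ℝ)⁻¹) fun ℓ _ => ?_).trans
      (by simp [mul_assoc])
    have h1 := hA.abs_rate_le ht (ξ i) ℓ (empirical ξ) (hπ i (ξ i))
    have h2 := abs_empirical_update_sub_le ξ i ℓ a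
    have h3 : |(Pi.single j 1 : Fin k → ℝ) (Function.update ξ i ℓ i)
        - (Pi.single j 1 : Fin k → ℝ) (ξ i)| ≤ 1 := by
      rw [Pi.single_apply, Pi.single_apply]; split_ifs <;> simp
    rw [sub_sub_sub_cancel_right, abs_mul (_ * _), abs_mul (_ - _)]
    refine mul_le_mul h1 ?_ (by positivity) ((abs_nonneg _).trans h1)
    simpa using mul_le_mul h2 h3 (abs_nonneg _) (by positivity)
  · intro n _ hn
    simp [Function.update_of_ne hn.symm]

/-- If all players but player `i` use `Γ`, the drift of the empirical measure is the mean field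
drift, up to the contribution of player `i`. -/
theorem HypothesisA.abs_gameGen_empirical_sub_le (hA : HypothesisA T B R U ν) (ht : t ∈ Icc 0 T)
    {Γ γ : Strategy k} (hΓ : ∀ j, Γ t j ∈ U) (hγ : ∀ j, γ t j ∈ U) (i : Fin N) (a : Fin k)
    (ξ : Fin N → Fin k) :
    |gameGen ν (Function.update (fun _ => Γ) i γ) t (fun η => empirical η a) ξ
      - adjointGen ν t (empirical ξ) (Γ t) (empirical ξ) a| ≤ 4 * k * (B * R) * (N : ℝ)⁻¹ := by
  rw [gameGen_empirical, adjointGen_apply,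
    sum_empirical_mul ξ (fun j => playerGen ν t (empirical ξ) (Γ t j) (Pi.single a 1) j),
    ← mul_sub, ← Finset.sum_sub_distrib,
    Finset.sum_eq_single i (fun m _ hm => by simp [Function.update_of_ne hm]) (by simp),
    Function.update_self, abs_mul, abs_of_nonneg (by positivity : (0 : ℝ) ≤ (N : ℝ)⁻¹), mul_comm]
  refine mul_le_mul_of_nonneg_right ((abs_sub _ _).trans ?_) (by positivity)
  have h1 := hA.abs_playerGen_le ht (ξ i) (empirical ξ) (hγ (ξ i)) (abs_single_le a)
  have h2 := hA.abs_playerGen_le ht (ξ i) (empirical ξ) (hΓ (ξ i)) (abs_single_le a)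
  linarith

end gameGen

/-! ### The mean field drift -/

namespace HypothesisA

variable {k : ℕ} {T B R : ℝ} {U : Set (E k)} {ν : ℝ → Fin k → Fin k → E k → ℝ} {t : ℝ}
  {γ : Fin k → E k}

theorem norm_adjointGen_le (hA : HypothesisA T B R U ν) (ht : t ∈ Icc 0 T) (hγ : ∀ j, γ j ∈ U)
    (y p : E k) : ‖adjointGen ν t y γ p‖ ≤ k * (k * (k * (B * R * 2))) * ‖p‖ := by
  refine (norm_le_sum_abs _).trans ?_
  refine (Finset.sum_le_card_nsmul _ _ (k * (k * (B * R * 2)) * ‖p‖) fun a _ => ?_).trans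
    (by simp [mul_assoc])
  rw [adjointGen_apply]
  refine (Finset.abs_sum_le_sum_abs _ _).trans ?_
  refine (Finset.sum_le_card_nsmul _ _ (‖p‖ * (k * (B * R * 2))) fun j _ => ?_).trans
    (by simp only [Finset.card_univ, Fintype.card_fin, nsmul_eq_mul]; exact le_of_eq (by ring))
  rw [abs_mul]
  have h1 := hA.abs_playerGen_le ht j y (hγ j) (abs_single_le a)
  exact mul_le_mul (abs_apply_le_norm p j) (by simpa using h1) (abs_nonneg _) (norm_nonneg _)

theorem hasTaylorBound_adjointGen (hA : HypothesisA T B R U ν) {L X : ℝ} (hL : 0 ≤ L)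
    (hν : ∀ j ℓ, IsRegularCoeff T L (fun t y => ν t j ℓ y)) (ht : t ∈ Icc 0 T)
    (hγ : ∀ j, γ j ∈ U) {x : E k} (hx : ‖x‖ ≤ X) (hR : 0 ≤ R) (a : Fin k) :
    HasTaylorBound (k * (X * (k * (L * R * 2)) + k * (B * R * 2) + k * (L * R * 2))) x
      (fun y => adjointGen ν t y γ y a) := by
  have h := HasTaylorBound.sum (K := X * (k * (L * R * 2)) + k * (B * R * 2) + k * (L * R * 2))
    (x := x) Finset.univ
    (F := fun j y => y j * playerGen ν t y (γ j) (Pi.single a 1) j) fun j => by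
      have h1 := hA.hasTaylorBound_playerGen hL hν ht j x (hγ j) (abs_single_le a)
      rw [mul_one] at h1
      refine h1.coord_mul j (fun y => ?_) ?_ ((abs_apply_le_norm x j).trans hx) (by positivity)
      · simpa using hA.abs_playerGen_sub_le hν ht j y x (hγ j) (abs_single_le a)
      · simpa using hA.abs_playerGen_le ht j x (hγ j) (abs_single_le a)
  simpa [adjointGen_apply] using h

theorem abs_adjointGen_sub_le (hA : HypothesisA T B R U ν) {L X : ℝ}
    (hν : ∀ j ℓ, IsRegularCoeff T L (fun t y => ν t j ℓ y)) (ht : t ∈ Icc 0 T)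
    (hγ : ∀ j, γ j ∈ U) {x : E k} (hx : ‖x‖ ≤ X) (y : E k) (a : Fin k) :
    |adjointGen ν t y γ y a - adjointGen ν t x γ x a|
      ≤ k * (k * (B * R * 2) + X * (k * (L * R * 2))) * ‖y - x‖ := by
  rw [adjointGen_apply, adjointGen_apply, ← Finset.sum_sub_distrib]
  refine (Finset.abs_sum_le_sum_abs _ _).trans ?_
  refine (Finset.sum_le_card_nsmul _ _
    ((k * (B * R * 2) + X * (k * (L * R * 2))) * ‖y - x‖) fun j _ => ?_).trans
    (by simp [mul_assoc])
  set Gy := playerGen ν t y (γ j) (Pi.single a 1) j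
  set Gx := playerGen ν t x (γ j) (Pi.single a 1) j
  have h1 : |Gy| ≤ k * (B * R * 2) := by
    simpa using hA.abs_playerGen_le ht j y (hγ j) (abs_single_le a)
  have h2 : |Gy - Gx| ≤ k * (L * R * 2) * ‖y - x‖ := by
    simpa using hA.abs_playerGen_sub_le hν ht j y x (hγ j) (abs_single_le a)
  have h3 : |y j - x j| ≤ ‖y - x‖ := by simpa using abs_apply_le_norm (y - x) j
  have h4 := (abs_apply_le_norm x j).trans hx
  rw [show y j * Gy - x j * Gx = (y j - x j) * Gy + x j * (Gy - Gx) by ring]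
  refine (abs_add_le _ _).trans ?_
  rw [abs_mul, abs_mul]
  have h5 := mul_le_mul h3 h1 (abs_nonneg _) (norm_nonneg _)
  have h6 := mul_le_mul h4 h2 (abs_nonneg _) ((norm_nonneg _).trans hx)
  linarith

end HypothesisA

/-! ### Laws solving the forward equation -/

/-- The law `p t` on the configurations solves the Kolmogorov forward equation, in weak form,
of the game with profile `π` started at `ξ₀`. -/
structure IsForwardLaw {k N : ℕ} (T : ℝ) (ν : ℝ → Fin k → Fin k → E k → ℝ)
    (π : Fin N → Strategy k) (ξ₀ : Fin N → Fin k) (p : ℝ → (Fin N → Fin k) → ℝ) : Prop where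
  nonneg : ∀ t ξ, 0 ≤ p t ξ
  sum_one : ∀ t, ∑ ξ, p t ξ = 1
  initial : ∀ f : (Fin N → Fin k) → ℝ, ∑ ξ, p 0 ξ * f ξ = f ξ₀
  forward : ∀ t ∈ Icc 0 T, ∀ f : (Fin N → Fin k) → ℝ,
    HasDerivWithinAt (fun s => ∑ ξ, p s ξ * f ξ) (∑ ξ, p t ξ * gameGen ν π t f ξ) (Icc 0 T) t

namespace IsForwardLaw

variable {k N : ℕ} {T : ℝ} {ν : ℝ → Fin k → Fin k → E k → ℝ} {π : Fin N → Strategy k}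
  {ξ₀ : Fin N → Fin k} {p : ℝ → (Fin N → Fin k) → ℝ} {t : ℝ}

theorem abs_expect_le (hp : IsForwardLaw T ν π ξ₀ p) {g h : (Fin N → Fin k) → ℝ}
    (hgh : ∀ ξ, |g ξ| ≤ h ξ) : |∑ ξ, p t ξ * g ξ| ≤ ∑ ξ, p t ξ * h ξ := by
  refine (Finset.abs_sum_le_sum_abs _ _).trans (Finset.sum_le_sum fun ξ _ => ?_)
  rw [abs_mul, abs_of_nonneg (hp.nonneg t ξ)]
  exact mul_le_mul_of_nonneg_left (hgh ξ) (hp.nonneg t ξ)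

theorem expect_affine (hp : IsForwardLaw T ν π ξ₀ p) (g : (Fin N → Fin k) → ℝ) (α β : ℝ) :
    ∑ ξ, p t ξ * (α * g ξ + β) = α * ∑ ξ, p t ξ * g ξ + β := by
  simp only [mul_add, Finset.sum_add_distrib, ← Finset.sum_mul, hp.sum_one, one_mul,
    Finset.mul_sum]
  congr 1
  exact Finset.sum_congr rfl fun ξ _ => by ring

theorem hasDerivWithinAt_apply (hp : IsForwardLaw T ν π ξ₀ p) (ht : t ∈ Icc 0 T)
    (ξ : Fin N → Fin k) : ∃ d, HasDerivWithinAt (fun s => p s ξ) d (Icc 0 T) t :=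
  ⟨_, by simpa [Pi.single_apply] using hp.forward t ht (Pi.single ξ 1)⟩

theorem continuousOn (hp : IsForwardLaw T ν π ξ₀ p) (ξ : Fin N → Fin k) :
    ContinuousOn (fun s => p s ξ) (Icc 0 T) := fun _ ht =>
  (hp.hasDerivWithinAt_apply ht ξ).choose_spec.continuousWithinAt

/-- Dynkin's formula for a time-dependent function. -/
theorem hasDerivWithinAt_expect (hp : IsForwardLaw T ν π ξ₀ p) (ht : t ∈ Icc 0 T)
    {f : ℝ → (Fin N → Fin k) → ℝ} {f' : (Fin N → Fin k) → ℝ}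
    (hf : ∀ ξ, HasDerivWithinAt (fun s => f s ξ) (f' ξ) (Icc 0 T) t) :
    HasDerivWithinAt (fun s => ∑ ξ, p s ξ * f s ξ)
      (∑ ξ, p t ξ * (f' ξ + gameGen ν π t (f t) ξ)) (Icc 0 T) t := by
  choose d hd using fun ξ => hp.hasDerivWithinAt_apply ht ξ
  -- Freeze `f` at time `t`; the remaining factor `f s - f t` vanishes at `s = t`.
  have h1 := hp.forward t ht (f t)
  have h2 : HasDerivWithinAt (fun s => ∑ ξ, p s ξ * (f s ξ - f t ξ))
      (∑ ξ, (d ξ * (f t ξ - f t ξ) + p t ξ * f' ξ)) (Icc 0 T) t :=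
    HasDerivWithinAt.fun_sum fun ξ _ => (hd ξ).fun_mul ((hf ξ).sub_const (f t ξ))
  have h3 := h1.fun_add h2
  have e1 : (fun s => ∑ ξ, p s ξ * f t ξ + ∑ ξ, p s ξ * (f s ξ - f t ξ))
      = fun s => ∑ ξ, p s ξ * f s ξ := by
    funext s
    rw [← Finset.sum_add_distrib]
    exact Finset.sum_congr rfl fun ξ _ => by ring
  have e2 : ∑ ξ, p t ξ * gameGen ν π t (f t) ξ + ∑ ξ, (d ξ * (f t ξ - f t ξ) + p t ξ * f' ξ)
      = ∑ ξ, p t ξ * (f' ξ + gameGen ν π t (f t) ξ) := by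
    rw [← Finset.sum_add_distrib]
    exact Finset.sum_congr rfl fun ξ _ => by ring
  rwa [e1, e2] at h3

end IsForwardLaw

/-! ### Fluctuations of the empirical measure -/

/-- All players but player `i`, who uses `γ`, use the mean field feedback `Γ`; the flow `x` solves
the kinetic equation for `Γ` and starts within `κ / N` of the initial empirical measure. -/
structure IsOnePlayerDeviation {k N : ℕ} (T B R L κ : ℝ) (U : Set (E k))
    (ν : ℝ → Fin k → Fin k → E k → ℝ) (x : ℝ → E k) (Γ γ : Strategy k) (i : Fin N)
    (ξ₀ : Fin N → Fin k) (p : ℝ → (Fin N → Fin k) → ℝ) : Prop where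
  hypA : HypothesisA T B R U ν
  kernel : ∀ j ℓ, IsRegularCoeff T L (fun t y => ν t j ℓ y)
  kinetic : ∀ t ∈ Icc 0 T, HasDerivWithinAt x (adjointGen ν t (x t) (Γ t) (x t)) (Icc 0 T) t
  mem : ∀ t ∈ Icc 0 T, ∀ j, Γ t j ∈ U
  mem' : ∀ t ∈ Icc 0 T, ∀ j, γ t j ∈ U
  initial : ‖empirical ξ₀ - x 0‖ ≤ κ * (N : ℝ)⁻¹
  law : IsForwardLaw T ν (Function.update (fun _ => Γ) i γ) ξ₀ p

namespace IsOnePlayerDeviation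

variable {k N : ℕ} {T B R L κ : ℝ} {U : Set (E k)} {ν : ℝ → Fin k → Fin k → E k → ℝ} {x : ℝ → E k}
  {Γ γ : Strategy k} {i : Fin N} {ξ₀ : Fin N → Fin k} {p : ℝ → (Fin N → Fin k) → ℝ} {t : ℝ}

theorem profile_mem (h : IsOnePlayerDeviation T B R L κ U ν x Γ γ i ξ₀ p) (ht : t ∈ Icc 0 T)
    (n : Fin N) (j : Fin k) : Function.update (fun _ => Γ) i γ n t j ∈ U := by
  rcases eq_or_ne n i with rfl | hn
  · simpa using h.mem' t ht j
  · simpa [Function.update_of_ne hn] using h.mem t ht j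

theorem hasDerivWithinAt_coord (h : IsOnePlayerDeviation T B R L κ U ν x Γ γ i ξ₀ p)
    (ht : t ∈ Icc 0 T) (a : Fin k) :
    HasDerivWithinAt (fun s => x s a) (adjointGen ν t (x t) (Γ t) (x t) a) (Icc 0 T) t :=
  (EuclideanSpace.proj (𝕜 := ℝ) a).hasFDerivAt.comp_hasDerivWithinAt t (h.kinetic t ht)

end IsOnePlayerDeviation

section moments

variable {k : ℕ} {T B R L κ : ℝ}

/-- The constant depends on the parameters only, not on the data or on `N`; this order of
quantifiers is used for all the estimates below. -/
theorem exists_norm_flow_le (hB : 0 ≤ B) (hR : 0 ≤ R) (hκ : 0 ≤ κ) :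
    ∃ X : ℝ, 0 ≤ X ∧ ∀ {N : ℕ} {U : Set (E k)} {ν : ℝ → Fin k → Fin k → E k → ℝ} {x : ℝ → E k}
      {Γ γ : Strategy k} {i : Fin N} {ξ₀ : Fin N → Fin k} {p : ℝ → (Fin N → Fin k) → ℝ},
      IsOnePlayerDeviation T B R L κ U ν x Γ γ i ξ₀ p → ∀ t ∈ Icc 0 T, ‖x t‖ ≤ X := by
  refine ⟨(1 + κ + 0) * Real.exp ((k * (k * (k * (B * R * 2))) + 1) * T), by positivity, ?_⟩
  intro N U ν x Γ γ i ξ₀ p h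
  refine norm_le_of_norm_deriv_le (by simp; positivity) le_rfl ?_ h.kinetic fun t ht => ?_
  · have h1 : x 0 = empirical ξ₀ - (empirical ξ₀ - x 0) := by abel
    rw [h1]
    refine (norm_sub_le _ _).trans (add_le_add (norm_empirical_le ξ₀) (h.initial.trans ?_))
    exact mul_le_of_le_one_right hκ (Nat.cast_inv_le_one N)
  · have := h.hypA.norm_adjointGen_le ht (h.mem t ht) (x t) (x t)
    linarith [norm_nonneg (x t)]

/-- The drift of the empirical measure, including the deviating player, against that of the flow. -/
theorem exists_drift_sub_le (hB : 0 ≤ B) (hR : 0 ≤ R) (hL : 0 ≤ L) (hκ : 0 ≤ κ) :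
    ∃ K : ℝ, 0 ≤ K ∧ ∀ {N : ℕ} {U : Set (E k)} {ν : ℝ → Fin k → Fin k → E k → ℝ} {x : ℝ → E k}
      {Γ γ : Strategy k} {i : Fin N} {ξ₀ : Fin N → Fin k} {p : ℝ → (Fin N → Fin k) → ℝ},
      IsOnePlayerDeviation T B R L κ U ν x Γ γ i ξ₀ p → ∀ t ∈ Icc 0 T, ∀ (a : Fin k) ξ,
      |gameGen ν (Function.update (fun _ => Γ) i γ) t (fun η => empirical η a) ξ
        - adjointGen ν t (x t) (Γ t) (x t) a| ≤ K * ‖empirical ξ - x t‖ + K * (N : ℝ)⁻¹ := by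
  obtain ⟨X, hX0, hX⟩ := exists_norm_flow_le (k := k) (T := T) (L := L) hB hR hκ
  refine ⟨k * (k * (B * R * 2) + X * (k * (L * R * 2))) + 4 * k * (B * R), by positivity, ?_⟩
  intro N U ν x Γ γ i ξ₀ p h t ht a ξ
  have h1 := h.hypA.abs_gameGen_empirical_sub_le ht (h.mem t ht) (h.mem' t ht) i a ξ
  have h2 := h.hypA.abs_adjointGen_sub_le h.kernel ht (h.mem t ht) (hX h t ht) (empirical ξ) a
  refine (abs_sub_le _ _ _).trans ((add_le_add h1 h2).trans ?_)
  have h3 : 0 ≤ k * (k * (B * R * 2) + X * (k * (L * R * 2))) * (N : ℝ)⁻¹ := by positivity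
  have h4 : 0 ≤ 4 * k * (B * R) * ‖empirical ξ - x t‖ := by positivity
  linarith

/-- The carré du champ of each coordinate of the empirical measure is of order `1/N`, and so is
its mean square distance to the flow. -/
theorem exists_second_moment_le (hB : 0 ≤ B) (hR : 0 ≤ R) (hL : 0 ≤ L) (hκ : 0 ≤ κ) :
    ∃ C : ℝ, 0 ≤ C ∧ ∀ {N : ℕ} {U : Set (E k)} {ν : ℝ → Fin k → Fin k → E k → ℝ} {x : ℝ → E k}
      {Γ γ : Strategy k} {i : Fin N} {ξ₀ : Fin N → Fin k} {p : ℝ → (Fin N → Fin k) → ℝ},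
      IsOnePlayerDeviation T B R L κ U ν x Γ γ i ξ₀ p → ∀ t ∈ Icc 0 T,
      ∑ ξ, p t ξ * ‖empirical ξ - x t‖ ^ 2 ≤ C * (N : ℝ)⁻¹ := by
  obtain ⟨K, hK0, hK⟩ := exists_drift_sub_le (k := k) (T := T) hB hR hL hκ
  refine ⟨(κ ^ 2 + k * (K + k * (B * R))) * Real.exp ((k * (3 * K) + 1) * T), by positivity, ?_⟩
  intro N U ν x Γ γ i ξ₀ p h
  set π := Function.update (fun _ : Fin N => Γ) i γ with hπ
  have hN0 : (0 : ℝ) ≤ (N : ℝ)⁻¹ := by positivity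
  have hN1 : (N : ℝ)⁻¹ ≤ 1 := Nat.cast_inv_le_one N
  set b : ℝ → Fin k → ℝ := fun t a => adjointGen ν t (x t) (Γ t) (x t) a with hb
  have hderiv : ∀ t ∈ Icc 0 T, HasDerivWithinAt
      (fun s => ∑ ξ, p s ξ * ∑ a, (empirical ξ a - x s a) * (empirical ξ a - x s a))
      (∑ ξ, p t ξ * (∑ a, (-b t a * (empirical ξ a - x t a) + (empirical ξ a - x t a) * -b t a)
        + gameGen ν π t
          (fun η => ∑ a, (empirical η a - x t a) * (empirical η a - x t a)) ξ)) (Icc 0 T) t := by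
    intro t ht
    exact h.law.hasDerivWithinAt_expect ht (f := fun s ξ => ∑ a,
        (empirical ξ a - x s a) * (empirical ξ a - x s a)) fun ξ =>
      HasDerivWithinAt.fun_sum fun a _ =>
        ((h.hasDerivWithinAt_coord ht a).const_sub _).fun_mul
          ((h.hasDerivWithinAt_coord ht a).const_sub _)
  have hsq : ∀ (t : ℝ) (ξ : Fin N → Fin k), ∑ a, (empirical ξ a - x t a) * (empirical ξ a - x t a)
      = ‖empirical ξ - x t‖ ^ 2 := fun t ξ => by
    rw [EuclideanSpace.real_norm_sq_eq]; simp [pow_two]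
  have hnn : ∀ t, 0 ≤ ∑ ξ, p t ξ * ∑ a, (empirical ξ a - x t a) * (empirical ξ a - x t a) :=
    fun t => Finset.sum_nonneg fun ξ _ => mul_nonneg (h.law.nonneg t ξ)
      (by rw [hsq]; positivity)
  have key := norm_le_of_norm_deriv_le (T := T) (K := k * (3 * K) + 1)
    (δ := κ ^ 2 * (N : ℝ)⁻¹) (ε := k * (K + k * (B * R)) * (N : ℝ)⁻¹)
    (by simp; positivity) (by positivity) ?_ hderiv ?_
  · intro t ht
    have := key t ht
    rw [Real.norm_eq_abs, abs_of_nonneg (hnn t)] at this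
    simp only [hsq] at this
    linarith
  · rw [Real.norm_eq_abs, abs_of_nonneg (hnn 0)]
    simp only [hsq]
    rw [h.law.initial (fun ξ => ‖empirical ξ - x 0‖ ^ 2)]
    calc ‖empirical ξ₀ - x 0‖ ^ 2 ≤ (κ * (N : ℝ)⁻¹) ^ 2 :=
          pow_le_pow_left₀ (norm_nonneg _) h.initial 2
      _ = κ ^ 2 * ((N : ℝ)⁻¹ * (N : ℝ)⁻¹) := by ring
      _ ≤ κ ^ 2 * (N : ℝ)⁻¹ := by
          gcongr
          exact mul_le_of_le_one_right hN0 hN1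
  · intro t ht
    rw [Real.norm_eq_abs, Real.norm_eq_abs, abs_of_nonneg (hnn t)]
    have hpt : ∀ ξ, |∑ a, (-b t a * (empirical ξ a - x t a) + (empirical ξ a - x t a) * -b t a)
        + gameGen ν π t (fun η => ∑ a, (empirical η a - x t a) * (empirical η a - x t a)) ξ|
        ≤ (k * (3 * K)) * ‖empirical ξ - x t‖ ^ 2 + k * (K + k * (B * R)) * (N : ℝ)⁻¹ := by
      intro ξ
      rw [gameGen_sum, ← Finset.sum_add_distrib]
      refine (Finset.abs_sum_le_sum_abs _ _).trans ?_
      refine (Finset.sum_le_card_nsmul _ _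
        (3 * K * ‖empirical ξ - x t‖ ^ 2 + (K + k * (B * R)) * (N : ℝ)⁻¹) fun a _ => ?_).trans
        (by simp only [Finset.card_univ, Fintype.card_fin, nsmul_eq_mul]; exact le_of_eq (by ring))
      rw [gameGen_mul, gameGen_sub_const (fun η => empirical η a)]
      have h1 := h.hypA.abs_gameCarre_empirical_le ht (h.profile_mem ht) a (x t a) ξ
      have h2 := hK h t ht a ξ
      have h3 : |empirical ξ a - x t a| ≤ ‖empirical ξ - x t‖ := by
        simpa using abs_apply_le_norm (empirical ξ - x t) a
      rw [← hπ] at h1 h2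
      set y := empirical ξ a - x t a
      set n := ‖empirical ξ - x t‖
      set G := gameGen ν π t (fun η => empirical η a) ξ
      set Q := gameCarre ν π t (fun η => empirical η a - x t a)
        (fun η => empirical η a - x t a) ξ
      have hn : 0 ≤ n := norm_nonneg _
      rw [show -b t a * y + y * -b t a + (y * G + y * G + Q) = 2 * (y * (G - b t a)) + Q by ring]
      refine (abs_add_le _ _).trans ?_
      rw [abs_mul, abs_mul, abs_two]
      have h4 := mul_le_mul h3 h2 (abs_nonneg _) hn
      -- Young's inequality, and `N⁻² ≤ N⁻¹`
      have h5 : 2 * (n * (N : ℝ)⁻¹) ≤ n ^ 2 + (N : ℝ)⁻¹ := by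
        nlinarith [sq_nonneg (n - (N : ℝ)⁻¹), mul_le_of_le_one_right hN0 hN1]
      nlinarith [mul_le_mul_of_nonneg_left h5 hK0]
    refine (h.law.abs_expect_le hpt).trans ?_
    rw [h.law.expect_affine]
    simp only [hsq]
    have := hnn t
    simp only [hsq] at this
    linarith

/-- The displacement of the empirical measure from the flow, correlated with the state of
player `i`, is of order `1/N`: its expectation solves a linear equation up to terms controlled by
the second moment. -/
theorem exists_mixed_moment_le (hB : 0 ≤ B) (hR : 0 ≤ R) (hL : 0 ≤ L) (hκ : 0 ≤ κ) :
    ∃ C : ℝ, 0 ≤ C ∧ ∀ {N : ℕ} {U : Set (E k)} {ν : ℝ → Fin k → Fin k → E k → ℝ} {x : ℝ → E k}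
      {Γ γ : Strategy k} {i : Fin N} {ξ₀ : Fin N → Fin k} {p : ℝ → (Fin N → Fin k) → ℝ},
      IsOnePlayerDeviation T B R L κ U ν x Γ γ i ξ₀ p → ∀ t ∈ Icc 0 T, ∀ a j : Fin k,
      |∑ ξ, p t ξ * ((empirical ξ a - x t a) * (Pi.single j 1 : Fin k → ℝ) (ξ i))|
        ≤ C * (N : ℝ)⁻¹ := by
  obtain ⟨X, hX0, hX⟩ := exists_norm_flow_le (k := k) (T := T) (L := L) hB hR hκ
  obtain ⟨S, hS0, hS⟩ := exists_second_moment_le (k := k) (T := T) hB hR hL hκ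
  -- `A₁` bounds the generator of player `i`, `A₂` its Lipschitz constant, `A₃` the expansion of
  -- the mean field drift, and `A₄` the carré du champ and the drift caused by player `i` alone.
  obtain ⟨A₁, hA₁⟩ : ∃ A₁ : ℝ, A₁ = k * (B * R * (2 * 1)) := ⟨_, rfl⟩
  obtain ⟨A₂, hA₂⟩ : ∃ A₂ : ℝ, A₂ = k * (L * R * (2 * 1)) := ⟨_, rfl⟩
  obtain ⟨A₃, hA₃⟩ : ∃ A₃ : ℝ,
    A₃ = k * (X * (k * (L * R * 2)) + k * (B * R * 2) + k * (L * R * 2)) := ⟨_, rfl⟩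
  have hA₁0 : 0 ≤ A₁ := by rw [hA₁]; positivity
  have hA₂0 : 0 ≤ A₂ := by rw [hA₂]; positivity
  have hA₃0 : 0 ≤ A₃ := by rw [hA₃]; positivity
  obtain ⟨A₄, hA₄⟩ : ∃ A₄ : ℝ, A₄ = 4 * k * (B * R) + k * (B * R) := ⟨_, rfl⟩
  have hA₄0 : 0 ≤ A₄ := by rw [hA₄]; positivity
  refine ⟨(κ + ((A₂ + A₃) * S + A₄)) * Real.exp ((k * A₁ + k * A₃ + 1) * T), by positivity, ?_⟩
  intro N U ν x Γ γ i ξ₀ p h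
  set π := Function.update (fun _ : Fin N => Γ) i γ with hπ
  have hN0 : (0 : ℝ) ≤ (N : ℝ)⁻¹ := by positivity
  set e : Fin k → Fin k → ℝ := fun j => Pi.single j 1 with he
  have he1 : ∀ j c, |e j c| ≤ 1 := fun j c => abs_single_le j c
  set b : ℝ → Fin k → ℝ := fun t a => adjointGen ν t (x t) (Γ t) (x t) a with hb
  set M : ℝ → Fin k × Fin k → ℝ :=
    fun t q => ∑ ξ, p t ξ * ((empirical ξ q.1 - x t q.1) * e q.2 (ξ i)) with hM
  set M' : ℝ → Fin k × Fin k → ℝ := fun t q => ∑ ξ, p t ξ * (-b t q.1 * e q.2 (ξ i)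
    + gameGen ν π t (fun η => (empirical η q.1 - x t q.1) * e q.2 (η i)) ξ) with hM'
  have hderiv : ∀ t ∈ Icc 0 T, HasDerivWithinAt M (M' t) (Icc 0 T) t := fun t ht =>
    hasDerivWithinAt_pi.2 fun q => h.law.hasDerivWithinAt_expect ht
      (f := fun s ξ => (empirical ξ q.1 - x s q.1) * e q.2 (ξ i)) fun ξ =>
        ((h.hasDerivWithinAt_coord ht q.1).const_sub _).mul_const _
  have key := norm_le_of_norm_deriv_le (T := T) (K := k * A₁ + k * A₃ + 1)
    (δ := κ * (N : ℝ)⁻¹) (ε := ((A₂ + A₃) * S + A₄) * (N : ℝ)⁻¹)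
    (by simp; positivity) (by positivity) ?_ hderiv ?_
  · intro t ht a j
    have h1 := (norm_le_pi_norm (M t) (a, j)).trans (key t ht)
    rw [Real.norm_eq_abs] at h1
    simp only [hM] at h1
    linarith
  · refine (pi_norm_le_iff_of_nonneg (by positivity)).2 fun q => ?_
    rw [Real.norm_eq_abs]
    simp only [hM]
    rw [h.law.initial (fun ξ => (empirical ξ q.1 - x 0 q.1) * e q.2 (ξ i)), abs_mul]
    have h1 : |empirical ξ₀ q.1 - x 0 q.1| ≤ ‖empirical ξ₀ - x 0‖ := by
      simpa using abs_apply_le_norm (empirical ξ₀ - x 0) q.1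
    exact (mul_le_of_le_one_right (abs_nonneg _) (he1 _ _)).trans (h1.trans h.initial)
  · intro t ht
    refine (pi_norm_le_iff_of_nonneg (by positivity)).2 fun q => ?_
    obtain ⟨a, j⟩ := q
    obtain ⟨c, hc, hcT⟩ := h.hypA.hasTaylorBound_adjointGen hL h.kernel ht (h.mem t ht)
      (hX h t ht) hR a
    rw [← hA₃] at hc hcT
    set A : Fin k → ℝ := fun c => playerGen ν t (x t) (γ t c) (e j) c with hA
    have hAb : ∀ c, |A c| ≤ A₁ := fun c => by
      rw [hA₁]; exact h.hypA.abs_playerGen_le ht c (x t) (h.mem' t ht c) (he1 j)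
    set lin : (Fin N → Fin k) → ℝ := fun ξ =>
      ∑ l, A l * ((empirical ξ a - x t a) * e l (ξ i))
        + ∑ l, c l * ((empirical ξ l - x t l) * e j (ξ i)) with hlin
    have hpt : ∀ ξ, |(-b t a * e j (ξ i)
        + gameGen ν π t (fun η => (empirical η a - x t a) * e j (η i)) ξ) - lin ξ|
        ≤ (A₂ + A₃) * ‖empirical ξ - x t‖ ^ 2 + A₄ * (N : ℝ)⁻¹ := by
      intro ξ
      rw [gameGen_mul, gameGen_sub_const (fun η => empirical η a), gameGen_player i (e j)]
      have hπi : π i = γ := by simp [hπ]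
      rw [hπi]
      have h1 := h.hypA.abs_gameCarre_player_le ht (h.profile_mem ht) a (x t a) i j ξ
      have h2 := h.hypA.abs_gameGen_empirical_sub_le ht (h.mem t ht) (h.mem' t ht) i a ξ
      have h3 : |empirical ξ a - x t a| ≤ ‖empirical ξ - x t‖ := by
        simpa using abs_apply_le_norm (empirical ξ - x t) a
      have h4 := h.hypA.abs_playerGen_sub_le h.kernel ht (ξ i) (empirical ξ) (x t)
        (h.mem' t ht (ξ i)) (he1 j)
      have h5 := hcT (empirical ξ)
      have h6 := he1 j (ξ i)
      rw [← hA₂] at h4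
      rw [← hπ] at h1 h2
      have hl1 : ∑ l, A l * ((empirical ξ a - x t a) * e l (ξ i))
          = (empirical ξ a - x t a) * A (ξ i) := by
        simp [he, Pi.single_apply, mul_comm]
      have hl2 : ∑ l, c l * ((empirical ξ l - x t l) * e j (ξ i))
          = (∑ l, c l * (empirical ξ l - x t l)) * e j (ξ i) := by
        simp only [Finset.sum_mul, mul_assoc]
      simp only [hlin, hl1, hl2]
      set y := empirical ξ a - x t a
      set n := ‖empirical ξ - x t‖
      set G := gameGen ν π t (fun η => empirical η a) ξ
      set Q := gameCarre ν π t (fun η => empirical η a - x t a) (fun η => e j (η i)) ξ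
      set P := playerGen ν t (empirical ξ) (γ t (ξ i)) (e j) (ξ i)
      set D := adjointGen ν t (empirical ξ) (Γ t) (empirical ξ) a
      set s := ∑ l, c l * (empirical ξ l - x t l)
      have hn : 0 ≤ n := norm_nonneg _
      have e1 : -b t a * e j (ξ i) + (y * P + e j (ξ i) * G + Q) - (y * A (ξ i) + s * e j (ξ i))
          = y * (P - A (ξ i)) + e j (ξ i) * (D - b t a - s) + e j (ξ i) * (G - D) + Q := by ring
      rw [e1]
      refine (abs_add_le _ _).trans ?_
      have f1 : |y * (P - A (ξ i))| ≤ n * (A₂ * n) := by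
        rw [abs_mul]; exact mul_le_mul h3 h4 (abs_nonneg _) hn
      have f2 : |e j (ξ i) * (D - b t a - s)| ≤ A₃ * n ^ 2 := by
        rw [abs_mul]; exact (mul_le_of_le_one_left (abs_nonneg _) h6).trans h5
      have f3 : |e j (ξ i) * (G - D)| ≤ 4 * k * (B * R) * (N : ℝ)⁻¹ := by
        rw [abs_mul]; exact (mul_le_of_le_one_left (abs_nonneg _) h6).trans h2
      have f4 := abs_add_le (y * (P - A (ξ i)) + e j (ξ i) * (D - b t a - s))
        (e j (ξ i) * (G - D))
      have f5 := abs_add_le (y * (P - A (ξ i))) (e j (ξ i) * (D - b t a - s))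
      rw [hA₄]
      have f6 : |Q| ≤ k * (B * R) * (N : ℝ)⁻¹ := h1
      nlinarith
    have h1 : |∑ ξ, p t ξ * ((-b t a * e j (ξ i)
        + gameGen ν π t (fun η => (empirical η a - x t a) * e j (η i)) ξ) - lin ξ)|
        ≤ (A₂ + A₃) * (S * (N : ℝ)⁻¹) + A₄ * (N : ℝ)⁻¹ := by
      refine (h.law.abs_expect_le hpt).trans ?_
      rw [h.law.expect_affine]
      have := mul_le_mul_of_nonneg_left (hS h t ht) (add_nonneg hA₂0 hA₃0)
      linarith
    have h2 : ∑ ξ, p t ξ * lin ξ = ∑ l, A l * M t (a, l) + ∑ l, c l * M t (l, j) := by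
      simp only [hlin, hM, mul_add, Finset.sum_add_distrib, Finset.mul_sum]
      congr 1
      · rw [Finset.sum_comm]
        exact Finset.sum_congr rfl fun l _ => Finset.sum_congr rfl fun ξ _ => by ring
      · rw [Finset.sum_comm]
        exact Finset.sum_congr rfl fun l _ => Finset.sum_congr rfl fun ξ _ => by ring
    have h3 : |∑ l, A l * M t (a, l)| ≤ k * (A₁ * ‖M t‖) := by
      refine (Finset.abs_sum_le_sum_abs _ _).trans ?_
      refine (Finset.sum_le_card_nsmul _ _ (A₁ * ‖M t‖) fun l _ => ?_).trans (by simp)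
      rw [abs_mul]
      exact mul_le_mul (hAb l) (norm_le_pi_norm (M t) (a, l)) (abs_nonneg _) hA₁0
    have h4 : |∑ l, c l * M t (l, j)| ≤ k * (A₃ * ‖M t‖) := by
      refine (Finset.abs_sum_le_sum_abs _ _).trans ?_
      refine (Finset.sum_le_card_nsmul _ _ (A₃ * ‖M t‖) fun l _ => ?_).trans (by simp)
      rw [abs_mul]
      exact mul_le_mul (hc l) (norm_le_pi_norm (M t) (l, j)) (abs_nonneg _) hA₃0
    have h5 : M' t (a, j) = ∑ ξ, p t ξ * ((-b t a * e j (ξ i)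
        + gameGen ν π t (fun η => (empirical η a - x t a) * e j (η i)) ξ) - lin ξ)
        + (∑ l, A l * M t (a, l) + ∑ l, c l * M t (l, j)) := by
      rw [← h2, ← Finset.sum_add_distrib]
      exact Finset.sum_congr rfl fun ξ _ => by ring
    rw [Real.norm_eq_abs, h5]
    refine (abs_add_le _ _).trans ?_
    have h6 := abs_add_le (∑ l, A l * M t (a, l)) (∑ l, c l * M t (l, j))
    have h7 := norm_nonneg (M t)
    linarith

/-- Replacing the empirical measure by the flow costs `O(1/N)` in expectation, even when the
observable also depends on the state of player `i`. -/
theorem exists_expect_sub_le (hB : 0 ≤ B) (hR : 0 ≤ R) (hL : 0 ≤ L) (hκ : 0 ≤ κ) :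
    ∃ C : ℝ, 0 ≤ C ∧ ∀ {N : ℕ} {U : Set (E k)} {ν : ℝ → Fin k → Fin k → E k → ℝ} {x : ℝ → E k}
      {Γ γ : Strategy k} {i : Fin N} {ξ₀ : Fin N → Fin k} {p : ℝ → (Fin N → Fin k) → ℝ},
      IsOnePlayerDeviation T B R L κ U ν x Γ γ i ξ₀ p → ∀ t ∈ Icc 0 T,
      ∀ (K : ℝ) (F : Fin k → E k → ℝ), 0 ≤ K → (∀ j, HasTaylorBound K (x t) (F j)) →
      |∑ ξ, p t ξ * (F (ξ i) (empirical ξ) - F (ξ i) (x t))| ≤ C * K * (N : ℝ)⁻¹ := by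
  obtain ⟨S, hS0, hS⟩ := exists_second_moment_le (k := k) (T := T) hB hR hL hκ
  obtain ⟨C, hC0, hC⟩ := exists_mixed_moment_le (k := k) (T := T) hB hR hL hκ
  refine ⟨k * (k * C) + S, by positivity, ?_⟩
  intro N U ν x Γ γ i ξ₀ p h t ht K F hK hF
  choose c hc hcF using hF
  have h1 : |∑ ξ, p t ξ * (F (ξ i) (empirical ξ) - F (ξ i) (x t)
      - ∑ a, c (ξ i) a * (empirical ξ a - x t a))| ≤ K * (S * (N : ℝ)⁻¹) := by
    refine (h.law.abs_expect_le (h := fun ξ => K * ‖empirical ξ - x t‖ ^ 2 + 0)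
      fun ξ => by simpa using hcF (ξ i) (empirical ξ)).trans ?_
    rw [h.law.expect_affine, add_zero]
    exact mul_le_mul_of_nonneg_left (hS h t ht) hK
  have h2 : ∑ ξ, p t ξ * ∑ a, c (ξ i) a * (empirical ξ a - x t a)
      = ∑ j, ∑ a, c j a * ∑ ξ, p t ξ *
        ((empirical ξ a - x t a) * (Pi.single j 1 : Fin k → ℝ) (ξ i)) := by
    calc ∑ ξ, p t ξ * ∑ a, c (ξ i) a * (empirical ξ a - x t a)
        = ∑ ξ, ∑ j, ∑ a, c j a * (p t ξ *
          ((empirical ξ a - x t a) * (Pi.single j 1 : Fin k → ℝ) (ξ i))) := by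
          refine Finset.sum_congr rfl fun ξ _ => ?_
          symm
          rw [Finset.sum_eq_single (ξ i)
            (fun j _ hj => by simp [hj.symm]) (by simp), Finset.mul_sum]
          refine Finset.sum_congr rfl fun a _ => ?_
          simp; ring
      _ = _ := by
          rw [Finset.sum_comm]
          refine Finset.sum_congr rfl fun j _ => ?_
          rw [Finset.sum_comm]
          exact Finset.sum_congr rfl fun a _ => (Finset.mul_sum _ _ _).symm
  have h3 : |∑ j, ∑ a, c j a * ∑ ξ, p t ξ *
        ((empirical ξ a - x t a) * (Pi.single j 1 : Fin k → ℝ) (ξ i))|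
      ≤ k * (k * (K * (C * (N : ℝ)⁻¹))) := by
    refine (Finset.abs_sum_le_sum_abs _ _).trans ?_
    refine (Finset.sum_le_card_nsmul _ _ (k * (K * (C * (N : ℝ)⁻¹))) fun j _ => ?_).trans (by simp)
    refine (Finset.abs_sum_le_sum_abs _ _).trans ?_
    refine (Finset.sum_le_card_nsmul _ _ (K * (C * (N : ℝ)⁻¹)) fun a _ => ?_).trans (by simp)
    rw [abs_mul]
    exact mul_le_mul (hc j a) (hC h t ht a j) (abs_nonneg _) hK
  have h4 : ∑ ξ, p t ξ * (F (ξ i) (empirical ξ) - F (ξ i) (x t))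
      = ∑ ξ, p t ξ * (F (ξ i) (empirical ξ) - F (ξ i) (x t)
        - ∑ a, c (ξ i) a * (empirical ξ a - x t a))
        + ∑ ξ, p t ξ * ∑ a, c (ξ i) a * (empirical ξ a - x t a) := by
    rw [← Finset.sum_add_distrib]
    exact Finset.sum_congr rfl fun ξ _ => by ring
  rw [h4, h2]
  refine (abs_add_le _ _).trans ((add_le_add h1 h3).trans (le_of_eq ?_))
  ring

end moments

/-! ### The forward equation of a realization of the game -/

theorem continuousOn_gameGen {k N : ℕ} {T L : ℝ} {ν : ℝ → Fin k → Fin k → E k → ℝ}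
    {π : Fin N → Strategy k} (hν : ∀ j ℓ, IsRegularCoeff T L (fun t y => ν t j ℓ y))
    (hπ : ∀ n j, ContinuousOn (fun t => π n t j) (Icc 0 T)) (f : (Fin N → Fin k) → ℝ)
    (ξ : Fin N → Fin k) : ContinuousOn (fun t => gameGen ν π t f ξ) (Icc 0 T) := by
  refine continuousOn_finsetSum _ fun n _ => continuousOn_finsetSum _ fun ℓ _ => ?_
  exact (((hν _ _).continuousOn _).mul
    ((EuclideanSpace.proj (𝕜 := ℝ) ℓ).continuous.comp_continuousOn (hπ n _))).mul continuousOn_const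

theorem continuousOn_runningPayoff {k : ℕ} {T L : ℝ} {J : ℝ → Fin k → Fin k → E k → ℝ}
    {u : ℝ → E k} (hJ : ∀ j ℓ, IsRegularCoeff T L (fun t y => J t j ℓ y))
    (hu : ContinuousOn u (Icc 0 T)) (j : Fin k) (y : E k) :
    ContinuousOn (fun t => runningPayoff J t j y (u t)) (Icc 0 T) := by
  refine (continuousOn_finsetSum _ fun ℓ _ => ?_).sub (hu.norm.pow 2)
  exact ((hJ _ _).continuousOn _).mul
    ((EuclideanSpace.proj (𝕜 := ℝ) ℓ).continuous.comp_continuousOn hu)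

section realization

variable {k N : ℕ} {T : ℝ} {Ω : Type*} [MeasurableSpace Ω] {P : Measure Ω}
  [IsProbabilityMeasure P] {X : ℝ → Ω → (Fin N → Fin k)}

theorem measurable_section (hX : Measurable (Function.uncurry X)) (t : ℝ) : Measurable (X t) :=
  hX.comp measurable_prodMk_left

theorem integrable_comp_section (hX : Measurable (Function.uncurry X)) (t : ℝ)
    (f : (Fin N → Fin k) → ℝ) : Integrable (fun ω => f (X t ω)) P := by
  refine Integrable.of_bound ((measurable_of_finite f).comp
    (measurable_section hX t)).aestronglyMeasurable (∑ ξ, ‖f ξ‖) (ae_of_all _ fun ω => ?_)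
  exact Finset.single_le_sum (f := fun ξ => ‖f ξ‖) (fun ξ _ => norm_nonneg _)
    (Finset.mem_univ (X t ω))

theorem integral_comp_section (hX : Measurable (Function.uncurry X)) (t : ℝ)
    (f : (Fin N → Fin k) → ℝ) : ∫ ω, f (X t ω) ∂P = ∑ ξ, P.real (X t ⁻¹' {ξ}) * f ξ := by
  have hm := measurable_section hX t
  have := Measure.isProbabilityMeasure_map (μ := P) hm.aemeasurable
  rw [← integral_map hm.aemeasurable (measurable_of_finite f).aestronglyMeasurable,
    integral_fintype (Integrable.of_finite)]
  refine Finset.sum_congr rfl fun ξ _ => ?_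
  rw [map_measureReal_apply hm (measurableSet_singleton ξ), smul_eq_mul]

theorem integrable_prod_comp_section (hX : Measurable (Function.uncurry X))
    {G : ℝ → (Fin N → Fin k) → ℝ} (hG : ∀ ξ, ContinuousOn (fun s => G s ξ) (Icc 0 T)) {t : ℝ}
    (ht : t ∈ Icc 0 T) :
    Integrable (fun z : ℝ × Ω => G z.1 (X z.1 z.2)) ((volume.restrict (Ioc 0 t)).prod P) := by
  have h1 : ∀ ξ, Integrable (fun s => G s ξ) (volume.restrict (Ioc 0 t)) := fun ξ =>
    (((hG ξ).integrableOn_compact isCompact_Icc).mono_set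
      (Ioc_subset_Icc_self.trans (Icc_subset_Icc_right ht.2)))
  have h2 : ∀ ξ, Integrable ((Function.uncurry X ⁻¹' {ξ}).indicator fun z : ℝ × Ω => G z.1 ξ)
      ((volume.restrict (Ioc 0 t)).prod P) := fun ξ =>
    ((h1 ξ).comp_fst P).indicator (hX (measurableSet_singleton ξ))
  have h3 := integrable_finsetSum Finset.univ fun ξ _ => h2 ξ
  refine h3.congr (ae_of_all _ fun z => ?_)
  dsimp only
  rw [Finset.sum_eq_single (X z.1 z.2)]
  · exact indicator_of_mem (by rfl) _
  · intro ξ _ hξ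
    exact indicator_of_notMem (fun h => hξ (by simpa [Function.uncurry] using Eq.symm h)) _
  · simp

theorem integrable_integral_section (hX : Measurable (Function.uncurry X))
    {G : ℝ → (Fin N → Fin k) → ℝ} (hG : ∀ ξ, ContinuousOn (fun s => G s ξ) (Icc 0 T)) {t : ℝ}
    (ht : t ∈ Icc 0 T) : Integrable (fun ω => ∫ s in (0 : ℝ)..t, G s (X s ω)) P := by
  simp only [intervalIntegral.integral_of_le ht.1]
  exact (integrable_prod_comp_section hX hG ht).integral_prod_right

theorem integrableOn_expect_section (hX : Measurable (Function.uncurry X))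
    {G : ℝ → (Fin N → Fin k) → ℝ} (hG : ∀ ξ, ContinuousOn (fun s => G s ξ) (Icc 0 T)) {t : ℝ}
    (ht : t ∈ Icc 0 T) :
    IntegrableOn (fun s => ∑ ξ, P.real (X s ⁻¹' {ξ}) * G s ξ) (Ioc 0 t) := by
  have := (integrable_prod_comp_section (P := P) hX hG ht).integral_prod_left
  simp only [fun s => integral_comp_section (P := P) hX s (G s)] at this
  exact this

theorem integral_integral_section (hX : Measurable (Function.uncurry X))
    {G : ℝ → (Fin N → Fin k) → ℝ} (hG : ∀ ξ, ContinuousOn (fun s => G s ξ) (Icc 0 T)) {t : ℝ}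
    (ht : t ∈ Icc 0 T) : ∫ ω, (∫ s in (0 : ℝ)..t, G s (X s ω)) ∂P
      = ∫ s in (0 : ℝ)..t, ∑ ξ, P.real (X s ⁻¹' {ξ}) * G s ξ := by
  simp only [intervalIntegral.integral_of_le ht.1]
  rw [← integral_integral_swap (integrable_prod_comp_section hX hG ht)]
  simp only [fun s => integral_comp_section (P := P) hX s (G s)]

/-- The forward equation. Dynkin's formula in integrated form makes the law continuous in time,
hence the integrand continuous and the law differentiable. -/
theorem IsGameProcess.isForwardLaw {L : ℝ} {ν : ℝ → Fin k → Fin k → E k → ℝ}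
    {π : Fin N → Strategy k} {ξ₀ : Fin N → Fin k}
    (hν : ∀ j ℓ, IsRegularCoeff T L (fun t y => ν t j ℓ y))
    (hπ : ∀ n j, ContinuousOn (fun t => π n t j) (Icc 0 T)) (h : IsGameProcess T ν π ξ₀ P X) :
    IsForwardLaw T ν π ξ₀ (fun t ξ => P.real (X t ⁻¹' {ξ})) := by
  have hX := h.measurable
  have hinit : ∀ f : (Fin N → Fin k) → ℝ, ∑ ξ, P.real (X 0 ⁻¹' {ξ}) * f ξ = f ξ₀ := fun f => by
    rw [← integral_comp_section hX,
      integral_congr_ae (h.initial.mono fun ω hω => by simp only [hω] : _ =ᵐ[P] fun _ => f ξ₀)]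
    simp
  have hdyn : ∀ f : (Fin N → Fin k) → ℝ, ∀ t ∈ Icc 0 T, ∑ ξ, P.real (X t ⁻¹' {ξ}) * f ξ
      = f ξ₀ + ∫ s in (0 : ℝ)..t, ∑ ξ, P.real (X s ⁻¹' {ξ}) * gameGen ν π s f ξ := by
    intro f t ht
    have hG := continuousOn_gameGen hν hπ f
    have hm := h.martingale f 0 ⟨le_rfl, ht.1.trans ht.2⟩ t ht univ MeasurableSet.univ
    have hi : Integrable (fun ω => f (X t ω) - f (X 0 ω)) P :=
      (integrable_comp_section hX t f).sub (integrable_comp_section hX 0 f)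
    rw [setIntegral_univ, integral_sub hi (integrable_integral_section hX hG ht),
      integral_sub (integrable_comp_section hX t f) (integrable_comp_section hX 0 f),
      integral_integral_section hX hG ht, integral_comp_section hX, integral_comp_section hX,
      hinit] at hm
    linarith
  have hcont : ∀ ξ, ContinuousOn (fun t => P.real (X t ⁻¹' {ξ})) (Icc 0 T) := fun ξ => by
    rcases lt_or_ge T 0 with hT | hT
    · simp [Icc_eq_empty_of_lt hT]
    have h1 : ∀ t ∈ Icc 0 T, P.real (X t ⁻¹' {ξ}) = (Pi.single ξ 1 : (Fin N → Fin k) → ℝ) ξ₀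
        + ∫ s in (0 : ℝ)..t, ∑ η, P.real (X s ⁻¹' {η}) * gameGen ν π s (Pi.single ξ 1) η :=
      fun t ht => by
        rw [← hdyn _ t ht]
        simp [Pi.single_apply]
    refine ContinuousOn.congr ?_ h1
    have h2 := integrableOn_expect_section (P := P) hX
      (continuousOn_gameGen hν hπ (Pi.single ξ 1)) (t := T) ⟨hT, le_rfl⟩
    rw [← integrableOn_Icc_iff_integrableOn_Ioc, ← uIcc_of_le hT] at h2
    have h3 := intervalIntegral.continuousOn_primitive_interval h2
    rw [uIcc_of_le hT] at h3
    exact continuousOn_const.add h3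
  refine ⟨fun t ξ => measureReal_nonneg, fun t => ?_, hinit, fun t ht f => ?_⟩
  · have := integral_comp_section (P := P) hX t (fun _ => 1)
    simpa using this.symm
  · have hc : ContinuousOn (fun s => ∑ ξ, P.real (X s ⁻¹' {ξ}) * gameGen ν π s f ξ) (Icc 0 T) :=
      continuousOn_finsetSum _ fun ξ _ => (hcont ξ).mul (continuousOn_gameGen hν hπ f ξ)
    exact ((hasDerivWithinAt_integral_of_continuousOn hc ht).const_add (f ξ₀)).congr
      (fun s hs => hdyn f s hs) (hdyn f t ht)

/-- The expected payoff depends on the realization only through its one-dimensional laws. -/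
theorem expectedPayoff_eq {L : ℝ} {J : ℝ → Fin k → Fin k → E k → ℝ} {VT : Fin k → E k → ℝ}
    {γ : Strategy k} (hT : 0 ≤ T) (hJ : ∀ j ℓ, IsRegularCoeff T L (fun t y => J t j ℓ y))
    (hγ : ∀ j, ContinuousOn (fun t => γ t j) (Icc 0 T)) (hX : Measurable (Function.uncurry X))
    (i : Fin N) :
    expectedPayoff T J VT i γ P X
      = (∫ s in (0 : ℝ)..T, ∑ ξ, P.real (X s ⁻¹' {ξ})
          * runningPayoff J s (ξ i) (empirical ξ) (γ s (ξ i)))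
        + ∑ ξ, P.real (X T ⁻¹' {ξ}) * VT (ξ i) (empirical ξ) := by
  have hG : ∀ ξ : Fin N → Fin k, ContinuousOn
      (fun s => runningPayoff J s (ξ i) (empirical ξ) (γ s (ξ i))) (Icc 0 T) := fun ξ =>
    continuousOn_runningPayoff hJ (hγ (ξ i)) _ _
  have hTT : T ∈ Icc 0 T := ⟨hT, le_rfl⟩
  rw [← integral_comp_section hX T (fun ξ => VT (ξ i) (empirical ξ)),
    ← integral_integral_section hX hG hTT,
    ← integral_add (integrable_integral_section hX hG hTT)
      (integrable_comp_section hX T (fun ξ => VT (ξ i) (empirical ξ)))]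
  rfl

end realization

/-! ### The mean field solution -/

theorem HypothesisA.mono {k : ℕ} {T B R B' R' : ℝ} {U : Set (E k)}
    {ν : ℝ → Fin k → Fin k → E k → ℝ} (h : HypothesisA T B R U ν) (hB : B ≤ B') (hR : R ≤ R') :
    HypothesisA T B' R' U ν :=
  ⟨h.convex, fun u hu => (h.bounded u hu).trans hR, h.diag, h.nonneg,
    fun t ht j ℓ y => (h.le_bound t ht j ℓ y).trans hB, h.rate_nonneg⟩

namespace IsRegularCoeff

variable {k : ℕ} {T L L' : ℝ} {g : ℝ → E k → ℝ}

theorem mono (h : IsRegularCoeff T L g) (hL : L ≤ L') : IsRegularCoeff T L' g :=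
  ⟨h.continuousOn, h.contDiff, fun t ht y z => (h.lipschitz t ht y z).trans (by gcongr),
    fun t ht y z => (h.lipschitz_grad t ht y z).trans (by gcongr)⟩

/-- Continuity in `t` alone suffices, as the Lipschitz constant in `y` is uniform in `t`. -/
theorem continuousOn_comp (h : IsRegularCoeff T L g) {x : ℝ → E k}
    (hx : ContinuousOn x (Icc 0 T)) : ContinuousOn (fun t => g t (x t)) (Icc 0 T) := by
  intro t ht
  have h1 : Tendsto (fun s => g s (x s) - g s (x t)) (𝓝[Icc 0 T] t) (𝓝 0) := by
    refine squeeze_zero_norm' (a := fun s => L * ‖x s - x t‖)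
      (eventually_nhdsWithin_of_forall fun s hs => h.lipschitz s hs _ _) ?_
    have : Tendsto (fun s => L * ‖x s - x t‖) (𝓝[Icc 0 T] t) (𝓝 (L * ‖x t - x t‖)) :=
      (((hx t ht).sub continuousWithinAt_const).norm.const_mul L)
    simpa using this
  have h2 := h1.add (h.continuousOn (x t) t ht)
  simpa [ContinuousWithinAt] using h2

end IsRegularCoeff

/-- The maximizer over a convex set of a linear form minus the squared norm depends on the linear
form in a Lipschitz way, by strong concavity. -/
theorem norm_sub_le_of_isMaxOn {F : Type*} [NormedAddCommGroup F] [InnerProductSpace ℝ F]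
    {U : Set F} (hU : Convex ℝ U) {c d u v : F} (hu : u ∈ U) (hv : v ∈ U)
    (hmu : IsMaxOn (fun w => inner ℝ c w - ‖w‖ ^ 2) U u)
    (hmv : IsMaxOn (fun w => inner ℝ d w - ‖w‖ ^ 2) U v) : ‖u - v‖ ≤ ‖c - d‖ := by
  have hm : (2⁻¹ : ℝ) • u + (2⁻¹ : ℝ) • v ∈ U := hU hu hv (by norm_num) (by norm_num) (by norm_num)
  have h1 := hmu hm
  have h2 := hmv hm
  simp only [mem_ofPred_eq] at h1 h2
  have h3 : ‖(2⁻¹ : ℝ) • u + (2⁻¹ : ℝ) • v‖ ^ 2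
      = 2⁻¹ * ‖u‖ ^ 2 + 2⁻¹ * ‖v‖ ^ 2 - 4⁻¹ * ‖u - v‖ ^ 2 := by
    rw [← smul_add, norm_smul, mul_pow, norm_add_sq_real, norm_sub_sq_real]
    norm_num
    ring
  rw [h3, inner_add_right, inner_smul_right, inner_smul_right] at h1 h2
  have h4 := real_inner_le_norm (c - d) (u - v)
  rw [inner_sub_left, inner_sub_right, inner_sub_right] at h4
  by_contra! h
  nlinarith [norm_nonneg (c - d), norm_nonneg (u - v)]

namespace IsMeanFieldSolution

variable {k : ℕ} {T B R L : ℝ} {U : Set (E k)} {ν J : ℝ → Fin k → Fin k → E k → ℝ}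
  {VT : Fin k → E k → ℝ} {x : ℝ → E k} {V : ℝ → Fin k → ℝ} {Γ : Strategy k}

theorem isAdmissible (h : IsMeanFieldSolution T U ν J VT x V Γ) (hA : HypothesisA T B R U ν)
    (hreg : HypothesisB T L ν J) : IsAdmissible T U Γ := by
  refine ⟨h.control_mem, fun j => ?_⟩
  set c : ℝ → E k := fun t => WithLp.toLp 2 fun ℓ =>
    J t j ℓ (x t) + ν t j ℓ (x t) * (V t ℓ - V t j) with hc
  have hx : ContinuousOn x (Icc 0 T) := fun t ht => (h.kinetic t ht).continuousWithinAt
  have hV : ∀ ℓ, ContinuousOn (fun t => V t ℓ) (Icc 0 T) :=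
    fun ℓ t ht => (h.hjb t ht ℓ).continuousWithinAt
  have hcc : ContinuousOn c (Icc 0 T) := by
    refine (PiLp.continuous_toLp 2 _).comp_continuousOn (continuousOn_pi.2 fun ℓ => ?_)
    exact ((hreg.payoff j ℓ).continuousOn_comp hx).add
      (((hreg.kernel j ℓ).continuousOn_comp hx).mul ((hV ℓ).sub (hV j)))
  have hmax : ∀ t ∈ Icc 0 T, IsMaxOn (fun w => inner ℝ (c t) w - ‖w‖ ^ 2) U (Γ t j) := by
    intro t ht
    convert h.control_max t ht j using 1
    funext w
    simp only [hc, preHamiltonian, runningPayoff, playerGen, PiLp.inner_apply,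
      RCLike.inner_apply, conj_trivial]
    rw [sub_add_eq_add_sub, ← Finset.sum_add_distrib]
    congr 1
    exact Finset.sum_congr rfl fun ℓ _ => by ring
  intro t ht
  rw [ContinuousWithinAt, tendsto_iff_norm_sub_tendsto_zero]
  refine squeeze_zero' (Eventually.of_forall fun s => norm_nonneg _)
    (eventually_nhdsWithin_of_forall fun s hs => norm_sub_le_of_isMaxOn hA.convex
      (h.control_mem s hs j) (h.control_mem t ht j) (hmax s hs) (hmax t ht)) ?_
  exact tendsto_iff_norm_sub_tendsto_zero.1 (hcc t ht)

/-- The value function is bounded linearly in the bounds on the payoffs. -/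
theorem norm_value_le (h : IsMeanFieldSolution T U ν J VT x V Γ) (hA : HypothesisA T B R U ν)
    (hB : 0 ≤ B) (hR : 0 ≤ R) {a w : ℝ} (ha0 : 0 ≤ a) (hw0 : 0 ≤ w)
    (ha : ∀ t ∈ Icc 0 T, ∀ j y, ∀ u ∈ U, |runningPayoff J t j y u| ≤ a)
    (hw : ∀ j y, |VT j y| ≤ w) :
    ∀ t ∈ Icc 0 T, ‖V t‖ ≤ (w + a) * Real.exp ((k * (B * R * 2) + 1) * T) := by
  refine norm_le_of_norm_deriv_le_backward (by simp; positivity) ha0 ?_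
    (fun t ht => hasDerivWithinAt_pi.2 fun j => h.hjb t ht j) fun t ht => ?_
  · refine (pi_norm_le_iff_of_nonneg hw0).2 fun j => ?_
    rw [h.terminal]; exact hw j _
  · refine (pi_norm_le_iff_of_nonneg (by positivity)).2 fun j => ?_
    rw [norm_neg, Real.norm_eq_abs]
    have h1 := hA.abs_playerGen_le ht j (x t) (h.control_mem t ht j) (norm_le_pi_norm (V t))
    have h2 := ha t ht j (x t) _ (h.control_mem t ht j)
    refine (abs_add_le _ _).trans ?_
    linarith [norm_nonneg (V t)]

end IsMeanFieldSolution

theorem hasTaylorBound_preHamiltonian {k : ℕ} {T B R L : ℝ} {U : Set (E k)}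
    {ν J : ℝ → Fin k → Fin k → E k → ℝ} (hA : HypothesisA T B R U ν) (hreg : HypothesisB T L ν J)
    (hL : 0 ≤ L) {t : ℝ} (ht : t ∈ Icc 0 T) (j : Fin k) (x : E k) {W : Fin k → ℝ}
    {M : ℝ} (hM : ∀ ℓ, |W ℓ| ≤ M) {u : E k} (hu : u ∈ U) :
    HasTaylorBound (k * (R * L) + k * (L * R * (2 * M))) x
      (fun y => preHamiltonian ν J t j y W u) := by
  have h1 : ∀ ℓ, HasTaylorBound (R * L) x (fun y => J t j ℓ y * u ℓ) := fun ℓ => by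
    have := (((hreg.payoff j ℓ).hasTaylorBound hL ht x).const_mul (u ℓ)).mono
      (mul_le_mul_of_nonneg_right ((abs_apply_le_norm u ℓ).trans (hA.bounded u hu)) hL)
    simpa only [mul_comm] using this
  have h2 := HasTaylorBound.sum Finset.univ h1
  have h3 := (h2.add (HasTaylorBound.const (K := 0) (-‖u‖ ^ 2) le_rfl)).add
    (hA.hasTaylorBound_playerGen hL hreg.kernel ht j x hu hM)
  simpa [preHamiltonian, runningPayoff, sub_eq_add_neg] using h3

/-! ### Verification -/

/-- Along the game the value function `V` of the limit problem is an approximate solution of the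
Hamilton–Jacobi–Bellman equation: the payoff of player `i` is at most `V (0, ξ₀ i)` plus an error
of order `1/N`, and this is sharp when she uses the mean field feedback. -/
theorem exists_payoff_sub_value_le {k : ℕ} {T B R L κ : ℝ} (hT : 0 ≤ T) (hB : 0 ≤ B) (hR : 0 ≤ R)
    (hL : 0 ≤ L) (hκ : 0 ≤ κ) :
    ∃ C : ℝ, 0 ≤ C ∧ ∀ {N : ℕ} {U : Set (E k)} {ν J : ℝ → Fin k → Fin k → E k → ℝ}
      {VT : Fin k → E k → ℝ} {x : ℝ → E k} {V : ℝ → Fin k → ℝ} {Γ γ : Strategy k} {i : Fin N}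
      {ξ₀ : Fin N → Fin k} {p : ℝ → (Fin N → Fin k) → ℝ} {a w : ℝ},
      IsOnePlayerDeviation T B R L κ U ν x Γ γ i ξ₀ p → HypothesisB T L ν J →
      IsMeanFieldSolution T U ν J VT x V Γ → (∀ j, ContinuousOn (fun t => γ t j) (Icc 0 T)) →
      0 ≤ a → 0 ≤ w → (∀ t ∈ Icc 0 T, ∀ j y, ∀ u ∈ U, |runningPayoff J t j y u| ≤ a) →
      (∀ j y, |VT j y| ≤ w) → (∀ j y, HasTaylorBound w y (VT j)) →
      ((∫ s in (0 : ℝ)..T, ∑ ξ, p s ξ * runningPayoff J s (ξ i) (empirical ξ) (γ s (ξ i)))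
          + ∑ ξ, p T ξ * VT (ξ i) (empirical ξ)
        ≤ V 0 (ξ₀ i) + C * (a + w + 1) * (N : ℝ)⁻¹) ∧
      (γ = Γ → V 0 (ξ₀ i) - C * (a + w + 1) * (N : ℝ)⁻¹
        ≤ (∫ s in (0 : ℝ)..T, ∑ ξ, p s ξ * runningPayoff J s (ξ i) (empirical ξ) (γ s (ξ i)))
          + ∑ ξ, p T ξ * VT (ξ i) (empirical ξ)) := by
  obtain ⟨C, hC0, hC⟩ := exists_expect_sub_le (k := k) (T := T) hB hR hL hκ
  obtain ⟨e, he⟩ : ∃ e : ℝ, e = Real.exp ((k * (B * R * 2) + 1) * T) := ⟨_, rfl⟩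
  have he0 : 0 ≤ e := by rw [he]; positivity
  refine ⟨C * (k * (R * L) + k * (L * R * (2 * e))) * T + C, by positivity, ?_⟩
  intro N U ν J VT x V Γ γ i ξ₀ p a w h hreg hmf hγ ha0 hw0 ha hw hVT
  have hN0 : (0 : ℝ) ≤ (N : ℝ)⁻¹ := by positivity
  have hV : ∀ t ∈ Icc 0 T, ∀ j, |V t j| ≤ (w + a) * e := fun t ht j => by
    rw [he]
    exact (norm_le_pi_norm (V t) j).trans (hmf.norm_value_le h.hypA hB hR ha0 hw0 ha hw t ht)
  set r : ℝ → ℝ := fun s => ∑ ξ, p s ξ * runningPayoff J s (ξ i) (empirical ξ) (γ s (ξ i)) with hr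
  have hrc : ContinuousOn r (Icc 0 T) := continuousOn_finsetSum _ fun ξ _ =>
    (h.law.continuousOn ξ).mul (continuousOn_runningPayoff hreg.payoff (hγ _) _ _)
  -- The expected value plus the payoff accumulated so far.
  set Ψ : ℝ → ℝ := fun t => ∑ ξ, p t ξ * V t (ξ i) + ∫ s in (0 : ℝ)..t, r s with hΨ
  set D : ℝ → ℝ := fun t => ∑ ξ, p t ξ * (preHamiltonian ν J t (ξ i) (empirical ξ) (V t) (γ t (ξ i))
    - preHamiltonian ν J t (ξ i) (x t) (V t) (γ t (ξ i))) with hD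
  set Z : ℝ → ℝ := fun t => ∑ ξ, p t ξ * (preHamiltonian ν J t (ξ i) (x t) (V t) (γ t (ξ i))
    - preHamiltonian ν J t (ξ i) (x t) (V t) (Γ t (ξ i))) with hZ
  have hderiv : ∀ t ∈ Icc 0 T, HasDerivWithinAt Ψ (D t + Z t) (Icc 0 T) t := by
    intro t ht
    have h1 := (h.law.hasDerivWithinAt_expect ht (f := fun s ξ => V s (ξ i))
      fun ξ => hmf.hjb t ht (ξ i)).fun_add (hasDerivWithinAt_integral_of_continuousOn hrc ht)
    refine h1.congr_deriv ?_
    change _ + ∑ ξ, p t ξ * runningPayoff J t (ξ i) (empirical ξ) (γ t (ξ i))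
      = D t + Z t
    rw [hD, hZ, ← Finset.sum_add_distrib, ← Finset.sum_add_distrib]
    refine Finset.sum_congr rfl fun ξ _ => ?_
    rw [gameGen_player i (V t) ξ, Function.update_self]
    simp only [preHamiltonian]
    ring
  have hDle : ∀ t ∈ Icc 0 T,
      |D t| ≤ C * (k * (R * L) + k * (L * R * (2 * ((w + a) * e)))) * (N : ℝ)⁻¹ := fun t ht =>
    hC h t ht _ (fun j y => preHamiltonian ν J t j y (V t) (γ t j)) (by positivity) fun j =>
      hasTaylorBound_preHamiltonian h.hypA hreg hL ht j (x t) (hV t ht) (h.mem' t ht j)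
  have hZle : ∀ t ∈ Icc 0 T, Z t ≤ 0 := fun t ht =>
    Finset.sum_nonpos fun ξ _ => mul_nonpos_of_nonneg_of_nonpos (h.law.nonneg t ξ)
      (sub_nonpos.2 (hmf.control_max t ht (ξ i) (h.mem' t ht (ξ i))))
  have hΨ0 : Ψ 0 = V 0 (ξ₀ i) := by
    simp only [hΨ, intervalIntegral.integral_same, add_zero]
    exact h.law.initial (fun ξ => V 0 (ξ i))
  have hterm : |∑ ξ, p T ξ * (VT (ξ i) (empirical ξ) - VT (ξ i) (x T))| ≤ C * w * (N : ℝ)⁻¹ :=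
    hC h T ⟨hT, le_rfl⟩ w VT hw0 fun j => hVT j (x T)
  have hpay : (∫ s in (0 : ℝ)..T, r s) + ∑ ξ, p T ξ * VT (ξ i) (empirical ξ)
      = Ψ T + ∑ ξ, p T ξ * (VT (ξ i) (empirical ξ) - VT (ξ i) (x T)) := by
    simp only [hΨ, hmf.terminal, mul_sub, Finset.sum_sub_distrib]
    ring
  have hconst : C * (k * (R * L) + k * (L * R * (2 * ((w + a) * e)))) * (N : ℝ)⁻¹ * T
      + C * w * (N : ℝ)⁻¹
      ≤ (C * (k * (R * L) + k * (L * R * (2 * e))) * T + C) * (a + w + 1) * (N : ℝ)⁻¹ := by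
    have h1 : 0 ≤ C * (k * (R * L)) * T * (N : ℝ)⁻¹ * (a + w) := by positivity
    have h2 : 0 ≤ C * (k * (L * R * (2 * e))) * T * (N : ℝ)⁻¹ := by positivity
    have h3 : 0 ≤ C * (a + 1) * (N : ℝ)⁻¹ := by positivity
    linarith
  rw [hpay]
  have hterm' := abs_le.1 hterm
  constructor
  · have := le_add_mul_of_deriv_le hT hderiv fun t ht =>
      (add_le_of_nonpos_right (hZle t ht)).trans ((le_abs_self _).trans (hDle t ht))
    linarith
  · rintro rfl
    have hZ0 : ∀ t, Z t = 0 := fun t => by simp [hZ]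
    have := le_add_mul_of_deriv_le hT (fun t ht => (hderiv t ht).fun_neg) fun t ht => by
      rw [hZ0, add_zero]
      exact (neg_le_abs _).trans (hDle t ht)
    linarith

/-! ### The norms of the data -/

theorem abs_runningPayoff_le {k : ℕ} {T : ℝ} {U : Set (E k)} {J : ℝ → Fin k → Fin k → E k → ℝ}
    (hfin : payoffSupNorm T U J ≠ ∞) {t : ℝ} (ht : t ∈ Icc 0 T) (j : Fin k) (y : E k) {u : E k}
    (hu : u ∈ U) : |runningPayoff J t j y u| ≤ (payoffSupNorm T U J).toReal := by
  have h : ‖runningPayoff J t j y u‖ₑ ≤ payoffSupNorm T U J := by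
    refine le_iSup₂_of_le t ht (le_iSup₂_of_le j y ?_)
    exact le_iSup₂ (f := fun u (_ : u ∈ U) => ‖runningPayoff J t j y u‖ₑ) u hu
  simpa [toReal_enorm] using ENNReal.toReal_mono hfin h

theorem bounds_of_c2Norm_ne_top {k : ℕ} {F : E k → ℝ} {c : ℝ≥0∞} (hc : c ≠ ∞)
    (hF : c2Norm univ F ≤ c) : ContDiff ℝ 2 F ∧ (∀ y, |F y| ≤ c.toReal) ∧
      ∀ y, ‖iteratedFDeriv ℝ 2 F y‖ ≤ c.toReal := by
  have hd : ContDiff ℝ 2 F := by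
    by_contra hd
    rw [c2Norm, if_neg hd, top_le_iff] at hF
    exact hc hF
  rw [c2Norm, if_pos hd] at hF
  refine ⟨hd, fun y => ?_, fun y => ?_⟩
  · have h : ‖F y‖ₑ ≤ c := (le_iSup₂ (f := fun y (_ : y ∈ univ) => ‖F y‖ₑ) y (mem_univ y)).trans
      (le_self_add.trans hF)
    simpa [toReal_enorm] using ENNReal.toReal_mono hc h
  · have h : ‖iteratedFDeriv ℝ 2 F y‖ₑ ≤ c :=
      (le_iSup₂ (f := fun y (_ : y ∈ univ) => ‖iteratedFDeriv ℝ 2 F y‖ₑ) y (mem_univ y)).trans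
        (le_add_self.trans hF)
    simpa [toReal_enorm] using ENNReal.toReal_mono hc h

theorem theorem6p6 (k : ℕ) (T B R L k₁ : ℝ) (hT : 0 ≤ T) :
    ∃ C : ℝ≥0, ∀ (U : Set (E k)) (ν J : ℝ → Fin k → Fin k → E k → ℝ),
      HypothesisA T B R U ν → HypothesisB T L ν J →
      ∀ VT : Fin k → E k → ℝ, (∀ j, IsC1Bounded (VT j)) →
      ∀ (x₀ : E k) (ξ : (N : ℕ) → Fin N → Fin k),
        (∀ N : ℕ, 1 ≤ N → ‖empirical (ξ N) - x₀‖ ≤ k₁ / N) →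
      ∀ N : ℕ, 1 ≤ N →
      ∀ (x : ℝ → E k) (V : ℝ → Fin k → ℝ) (Γ : Strategy k),
        IsMeanFieldSolution T U ν J VT x V Γ →
        (x 0 = empirical (ξ N) ∨ x 0 = x₀) →
        IsEpsNash.{v} T U ν J VT (ξ N) (fun _ => Γ)
          ((C : ℝ≥0∞) / N * (payoffSupNorm T U J + payoffDualNorm T U J
            + (⨆ j, c2Norm univ (VT j)) + 1)) := by
  obtain ⟨C, hC0, hC⟩ := exists_payoff_sub_value_le (k := k) hT (abs_nonneg B) (abs_nonneg R)
    (abs_nonneg L) (abs_nonneg k₁)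
  -- Two payoffs are compared, and the terminal payoff enters with the factor `3`; the summand `1`
  -- makes the constant positive, so that the error is infinite as soon as one of the norms is.
  refine ⟨(6 * C + 1).toNNReal, ?_⟩
  intro U ν J hA hreg VT _ x₀ ξ hξ N hN x V Γ hmf hx0
  have hΓ := hmf.isAdmissible hA hreg
  refine ⟨fun _ => hΓ, ?_⟩
  intro i γ hγ Ω _ P _ X Ω' _ P' _ X' hX hX'
  set a := payoffSupNorm T U J with ha
  set c := ⨆ j, c2Norm univ (VT j) with hc
  have hNpos : (0 : ℝ) < N := by exact_mod_cast hN
  have hcoef : ENNReal.ofReal (6 * C + 1) / N ≠ 0 :=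
    (ENNReal.div_pos (ENNReal.ofReal_pos.2 (by positivity)).ne' (ENNReal.natCast_ne_top N)).ne'
  change _ ≤ ENNReal.ofReal (6 * C + 1) / N * _
  by_cases hfin : a = ∞ ∨ c = ∞
  · have : a + payoffDualNorm T U J + c + 1 = ∞ := by rcases hfin with h | h <;> simp [h]
    rw [this, ENNReal.mul_top hcoef]
    exact le_top
  obtain ⟨hafin, hcfin⟩ := not_or.1 hfin
  have hA' := hA.mono (le_abs_self B) (le_abs_self R)
  have hreg' : HypothesisB T |L| ν J := ⟨fun j ℓ => (hreg.kernel j ℓ).mono (le_abs_self L),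
    fun j ℓ => (hreg.payoff j ℓ).mono (le_abs_self L)⟩
  have hinit : ‖empirical (ξ N) - x 0‖ ≤ |k₁| * (N : ℝ)⁻¹ := by
    rcases hx0 with h | h
    · rw [h, sub_self, norm_zero]; positivity
    · rw [h, ← div_eq_mul_inv]
      exact (hξ N hN).trans (by gcongr; exact le_abs_self k₁)
  have hVT : ∀ j, c2Norm univ (VT j) ≤ c := fun j => le_iSup (fun j => c2Norm univ (VT j)) j
  -- A bound `c` on `VT` and its second derivative gives an expansion with constant `2 * c + c`.
  have hw : ∀ j y, |VT j y| ≤ 3 * c.toReal := fun j y =>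
    ((bounds_of_c2Norm_ne_top hcfin (hVT j)).2.1 y).trans
      (by linarith [ENNReal.toReal_nonneg (a := c)])
  have hw' : ∀ j y, HasTaylorBound (3 * c.toReal) y (VT j) := fun j y => by
    obtain ⟨h1, h2, h3⟩ := bounds_of_c2Norm_ne_top hcfin (hVT j)
    exact (hasTaylorBound_of_second_derivative h1 h2 h3 y).mono (by linarith)
  have key : ∀ γ, IsAdmissible T U γ → ∀ {p}, IsForwardLaw T ν (Function.update (fun _ => Γ) i γ)
      (ξ N) p → _ := fun γ hγ p hp =>
    hC (a := a.toReal) (w := 3 * c.toReal)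
      ⟨hA', hreg'.kernel, hmf.kinetic, hmf.control_mem, hγ.mem, hinit, hp⟩ hreg' hmf
      hγ.continuousOn ENNReal.toReal_nonneg (by positivity)
      (fun t ht j y u hu => abs_runningPayoff_le hafin ht j y hu) hw hw'
  have hprofile : ∀ n j, ContinuousOn (fun t => Function.update (fun _ : Fin N => Γ) i γ n t j)
      (Icc 0 T) := fun n j => by
    rcases eq_or_ne n i with rfl | hn
    · simpa using hγ.continuousOn j
    · simpa [Function.update_of_ne hn] using hΓ.continuousOn j
  have hdev := (key γ hγ (hX'.isForwardLaw hreg.kernel hprofile)).1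
  have hlaw := hX.isForwardLaw hreg.kernel fun _ => hΓ.continuousOn
  rw [← Function.update_eq_self i (fun _ : Fin N => Γ)] at hlaw
  have heq := (key Γ hΓ hlaw).2 rfl
  rw [← expectedPayoff_eq hT hreg.payoff hγ.continuousOn hX'.measurable] at hdev
  rw [← expectedPayoff_eq hT hreg.payoff hΓ.continuousOn hX.measurable] at heq
  have hdiff : expectedPayoff T J VT i γ P' X' - expectedPayoff T J VT i Γ P X
      ≤ (6 * C + 1) / N * (a.toReal + c.toReal + 1) := by
    have h1 : 0 ≤ (4 * a.toReal * C + 4 * C + a.toReal + c.toReal + 1) * (N : ℝ)⁻¹ := by positivity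
    rw [div_eq_mul_inv]
    linarith
  calc ENNReal.ofReal (expectedPayoff T J VT i γ P' X' - expectedPayoff T J VT i Γ P X)
      ≤ ENNReal.ofReal ((6 * C + 1) / N * (a.toReal + c.toReal + 1)) :=
        ENNReal.ofReal_le_ofReal hdiff
    _ = ENNReal.ofReal (6 * C + 1) / N * (a + c + 1) := by
        rw [ENNReal.ofReal_mul (by positivity), ENNReal.ofReal_div_of_pos hNpos,
          ENNReal.ofReal_natCast, ENNReal.ofReal_add (p := a.toReal + c.toReal) (by positivity)
            zero_le_one,
          ENNReal.ofReal_add (p := a.toReal) (by positivity) (by positivity),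
          ENNReal.ofReal_toReal hafin,
          ENNReal.ofReal_toReal hcfin, ENNReal.ofReal_one]
    _ ≤ _ := by gcongr; exact le_self_add
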